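/- Let $n\ge 3$, let $\diamond^n=\operatorname{conv}\{\pm e_1,\dots,\pm e_n\}\subset\mathbb{R}^n$ be the standard cross-polytope, and let $\varphi:\mathbb{R}^n\to\mathbb{R}$ be a generic linear functional, i.e. one taking distinct values at distinct vertices of $\diamond^n$. Let $m$ be the index with $|\varphi(e_m)|$ maximal, so that $\pm e_m$ are the $\varphi$-minimal and $\varphi$-maximal vertices. A section of $\varphi:\diamond^n\to\varphi(\diamond^n)$ is a continuous map $s:\varphi(\diamond^n)\to\diamond^n$ with $\varphi(s(x))=x$ for all $x$, and the monotone path polytope $MPP_\varphi(\diamond^n)$ is the convex hull of the average values $$\frac{1}{|\varphi(\diamond^n)|}\int_{\varphi(\diamond^n)}s(x)\,dx$$ of all sections $s$. A monotone path is a sequence of vertices of $\diamond^n$ from the $\varphi$-minimal to the $\varphi$-maximal vertex in which consecutive vertices are joined by an edge of $\diamond^n$ along which $\varphi$ increases; it determines a section, whose values run along these edges. Say that a sign vector $\sigma\in\{0,+1,-1\}^{[n]\setminus\{m\}}$ is associated with a point $v$ if $v$ is the average value of the section of a monotone path which, for every $i\ne m$, visits $e_i$ if and only if $\sigma_i=+1$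 and visits $-e_i$ if and only if $\sigma_i=-1$. Then every vertex $v$ of $MPP_\varphi(\diamond^n)$ has exactly one associated sign vector $\sigma(v)$, the map $v\mapsto\sigma(v)$ is a bijection from the vertices of $MPP_\varphi(\diamond^n)$ onto $\{0,+1,-1\}^{[n]\setminus\{m\}}\setminus\{\mathbf 0\}$, and two vertices $v,w$ of $MPP_\varphi(\diamond^n)$ are adjacent (that is, $v\neq w$ and the segment $[v,w]$ is a face of $MPP_\varphi(\diamond^n)$) if and only if $\sigma(v)$ and $\sigma(w)$ are at taxicab distance $1$: $$\sum_{i\ne m}|\sigma(v)_i-\sigma(w)_i|=1 .$$ -/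

import Mathlib

open MeasureTheory

/-- Sections of `φ : P → φ(P)`: continuous maps `s` on `φ(P)` with values in `P` and
`φ ∘ s = id`. (Values of `s` outside `φ(P)` play no role.) -/
def IsSection {E : Type*} [NormedAddCommGroup E] [NormedSpace ℝ E]
    (P : Set E) (φ : E →L[ℝ] ℝ) (s : ℝ → E) : Prop :=
  ContinuousOn s (φ '' P) ∧ ∀ x ∈ φ '' P, s x ∈ P ∧ φ (s x) = x

/-- The monotone path polytope of `(P, φ)`: the convex hull of the average values over `φ(P)`
of all sections of `φ : P → φ(P)`. -/
noncomputable def monotonePathPolytope {E : Type*} [NormedAddCommGroup E] [NormedSpace ℝ E]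
    (P : Set E) (φ : E →L[ℝ] ℝ) : Set E :=
  convexHull ℝ {y | ∃ s : ℝ → E, IsSection P φ s ∧ y = ⨍ x in φ '' P, s x}

/-- `p` and `q` are adjacent in the polytope `P`: they are distinct and `[p, q]` is a face
of `P`, that is, the set of maximizers over `P` of some linear functional. -/
def PolytopeAdj {E : Type*} [NormedAddCommGroup E] [NormedSpace ℝ E]
    (P : Set E) (p q : E) : Prop :=
  p ≠ q ∧ IsExposed ℝ P (segment ℝ p q)

/-- A functional is generic for `P` if it takes distinct values at distinct vertices of `P`. -/
def IsVertexGeneric {E : Type*} [NormedAddCommGroup E] [NormedSpace ℝ E]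
    (P : Set E) (φ : E →L[ℝ] ℝ) : Prop :=
  Set.InjOn φ (Set.extremePoints ℝ P)

/-- A `φ`-monotone (edge) path on `P`, given by the list of its vertices: it starts at a
`φ`-minimal vertex, ends at a `φ`-maximal vertex, and consecutive entries are joined by an edge
of `P` along which `φ` increases. -/
def IsMonotonePath {E : Type*} [NormedAddCommGroup E] [NormedSpace ℝ E]
    (P : Set E) (φ : E →L[ℝ] ℝ) (l : List E) : Prop :=
  (∃ p ∈ l.head?, p ∈ Set.extremePoints ℝ P ∧ IsMinOn φ P p) ∧
  (∃ q ∈ l.getLast?, q ∈ Set.extremePoints ℝ P ∧ IsMaxOn φ P q) ∧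
  l.IsChain (fun p q => φ p < φ q ∧ PolytopeAdj P p q)

/-- The section `s` runs along the path with vertex list `l`: each of its values lies on the
segment between two consecutive entries of `l`. -/
def SectionTraces {E : Type*} [NormedAddCommGroup E] [NormedSpace ℝ E]
    (P : Set E) (φ : E →L[ℝ] ℝ) (s : ℝ → E) (l : List E) : Prop :=
  IsSection P φ s ∧ ∀ x ∈ φ '' P, ∃ p q : E, [p, q] <:+: l ∧ s x ∈ segment ℝ p q

/-- The `i`-th standard basis vector of `ℝⁿ`. -/
noncomputable def stdVec {n : ℕ} (i : Fin n) : EuclideanSpace ℝ (Fin n) :=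
  EuclideanSpace.single i 1

/-- The standard cross-polytope `◇ⁿ = conv {±e₁, …, ±eₙ}`. -/
def crossPolytope (n : ℕ) : Set (EuclideanSpace ℝ (Fin n)) :=
  convexHull ℝ {v | ∃ i : Fin n, v = stdVec i ∨ v = -stdVec i}

/-- `σ` is a sign vector associated with the point `v`: `v` is the average value of (the section
along) a `φ`-monotone path on `◇ⁿ` which, for every `i ≠ m`, visits `eᵢ` iff `σᵢ = +` and
visits `-eᵢ` iff `σᵢ = -` (hence neither of them iff `σᵢ = 0`). -/
def IsSignVectorOf {n : ℕ} (φ : EuclideanSpace ℝ (Fin n) →L[ℝ] ℝ) (m : Fin n)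
    (v : EuclideanSpace ℝ (Fin n)) (σ : {i : Fin n // i ≠ m} → SignType) : Prop :=
  ∃ (l : List (EuclideanSpace ℝ (Fin n))) (s : ℝ → EuclideanSpace ℝ (Fin n)),
    IsMonotonePath (crossPolytope n) φ l ∧
    SectionTraces (crossPolytope n) φ s l ∧
    v = ⨍ x in φ '' crossPolytope n, s x ∧
    ∀ i : {i : Fin n // i ≠ m},
      (stdVec i.1 ∈ l ↔ σ i = 1) ∧ (-stdVec i.1 ∈ l ↔ σ i = -1)

/-- The taxicab distance between two sign vectors. -/
def taxicabDist {ι : Type*} [Fintype ι] (σ τ : ι → SignType) : ℤ :=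
  ∑ i, |(σ i : ℤ) - (τ i : ℤ)|

theorem mem_of_pair_infix {α : Type*} {p q : α} {l : List α} (h : [p, q] <:+: l) : p ∈ l ∧ q ∈ l :=
  ⟨h.subset (by simp), h.subset (by simp)⟩

section PathSection

variable {E : Type*} [NormedAddCommGroup E] [NormedSpace ℝ E] {φ : E →L[ℝ] ℝ}

/-- The point of the line through `p` and `q` at `φ`-height `x`. -/
noncomputable def interp (φ : E →L[ℝ] ℝ) (p q : E) (x : ℝ) : E :=
  AffineMap.lineMap p q ((x - φ p) / (φ q - φ p))

theorem apply_interp (c : E →L[ℝ] ℝ) (p q : E) (x : ℝ) :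
    c (interp φ p q x) = c p + (x - φ p) / (φ q - φ p) * (c q - c p) := by
  simp only [interp, AffineMap.lineMap_apply_module', map_add, map_smul, map_sub, smul_eq_mul]
  ring

theorem apply_interp_self {p q : E} (h : φ p < φ q) (x : ℝ) : φ (interp φ p q x) = x := by
  rw [apply_interp, div_mul_cancel₀ _ (sub_pos.2 h).ne']
  ring

theorem apply_interp_eq_affine {c : E →L[ℝ] ℝ} {p q : E} (h : φ p < φ q) {α β : ℝ}
    (hp : c p = α + β * φ p) (hq : c q = α + β * φ q) (x : ℝ) :
    c (interp φ p q x) = α + β * x := by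
  have : φ q - φ p ≠ 0 := (sub_pos.2 h).ne'
  rw [apply_interp, hp, hq]
  field_simp
  ring

theorem interp_mem_segment {p q : E} (h : φ p < φ q) {x : ℝ} (h₁ : φ p ≤ x) (h₂ : x ≤ φ q) :
    interp φ p q x ∈ segment ℝ p q := by
  rw [segment_eq_image_lineMap]
  refine ⟨_, ⟨div_nonneg (sub_nonneg.2 h₁) (sub_pos.2 h).le, ?_⟩, rfl⟩
  rw [div_le_one (sub_pos.2 h)]
  linarith

theorem eq_interp_of_mem_segment {p q y : E} (h : φ p < φ q) (hy : y ∈ segment ℝ p q) :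
    y = interp φ p q (φ y) := by
  rw [segment_eq_image_lineMap] at hy
  obtain ⟨t, -, rfl⟩ := hy
  have : φ q - φ p ≠ 0 := (sub_pos.2 h).ne'
  rw [interp]
  congr 1
  simp only [AffineMap.lineMap_apply_module', map_add, map_smul, map_sub, smul_eq_mul]
  field_simp
  ring

theorem le_apply_of_mem_segment {p q y : E} (h : φ p < φ q) (hy : y ∈ segment ℝ p q) :
    φ p ≤ φ y ∧ φ y ≤ φ q := by
  obtain ⟨a, b, ha, hb, hab, rfl⟩ := hy
  obtain rfl : a = 1 - b := by linarith
  simp only [map_add, map_smul, smul_eq_mul]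
  constructor <;> nlinarith

theorem interp_left (p q : E) : interp φ p q (φ p) = p := by simp [interp]

theorem interp_right {p q : E} (h : φ p < φ q) : interp φ p q (φ q) = q := by
  rw [interp, div_self (sub_pos.2 h).ne', AffineMap.lineMap_apply_one]

theorem continuous_interp (p q : E) : Continuous (interp φ p q) := by
  unfold interp
  fun_prop

/-- The piecewise linear section of `φ` whose graph runs through the points of a list. -/
noncomputable def pathSection (φ : E →L[ℝ] ℝ) : List E → ℝ → E
  | [], _ => 0
  | [p], _ => p
  | p :: q :: l, x => if x ≤ φ q then interp φ p q x else pathSection φ (q :: l) x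

/-- A list along which `φ` increases strictly. -/
abbrev IsIncreasing (φ : E →L[ℝ] ℝ) (l : List E) : Prop := l.Pairwise fun p q => φ p < φ q

theorem pathSection_head {p : E} {l : List E} (h : IsIncreasing φ (p :: l)) :
    pathSection φ (p :: l) (φ p) = p := by
  cases l with
  | nil => rfl
  | cons q l =>
    have : φ p < φ q := List.rel_of_pairwise_cons h (by simp)
    rw [pathSection, if_pos this.le, interp_left]

theorem continuous_pathSection {l : List E} (h : IsIncreasing φ l) :
    Continuous (pathSection φ l) := by
  induction l with
  | nil => exact continuous_const
  | cons p l ih =>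
    cases l with
    | nil => exact continuous_const
    | cons q l =>
      have hpq : φ p < φ q := List.rel_of_pairwise_cons h (by simp)
      have h' := h.of_cons
      refine Continuous.if_le (continuous_interp p q) (ih h') continuous_id continuous_const ?_
      rintro x rfl
      rw [interp_right hpq, pathSection_head h']

theorem IsIncreasing.lt_of_infix {l : List E} (h : IsIncreasing φ l) {p q : E}
    (hpq : [p, q] <:+: l) : φ p < φ q :=
  List.rel_of_pairwise_cons (h.sublist hpq.sublist) (by simp)

theorem pathSection_eq_of_mem_segment {l : List E} (h : IsIncreasing φ l) {p q y : E}
    (hpq : [p, q] <:+: l) (hy : y ∈ segment ℝ p q) : pathSection φ l (φ y) = y := by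
  induction l with
  | nil => simp at hpq
  | cons a l ih =>
    have hlt := h.lt_of_infix hpq
    have hle := le_apply_of_mem_segment hlt hy
    rcases List.infix_cons_iff.1 hpq with hpre | hinf
    · obtain ⟨rfl, t, rfl⟩ := List.cons_prefix_cons.1 hpre
      rw [List.singleton_append, pathSection, if_pos hle.2]
      exact (eq_interp_of_mem_segment hlt hy).symm
    · have ih := ih h.of_cons hinf
      cases l with
      | nil => simp at hinf
      | cons b l =>
        have hab : φ a < φ b := List.rel_of_pairwise_cons h (by simp)
        have hbp : φ b ≤ φ p := by
          rcases List.mem_cons.1 (mem_of_pair_infix hinf).1 with rfl | hp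
          · exact le_rfl
          · exact (List.rel_of_pairwise_cons h.of_cons hp).le
        rw [pathSection]
        split_ifs with hx
        · have hyb : φ y = φ b := le_antisymm hx (hbp.trans hle.1)
          rw [hyb, interp_right hab]
          rw [hyb, pathSection_head h.of_cons] at ih
          exact ih
        · exact ih

theorem pathSection_eq_interp {l : List E} (h : IsIncreasing φ l) {p q : E}
    (hpq : [p, q] <:+: l) {x : ℝ} (h₁ : φ p ≤ x) (h₂ : x ≤ φ q) :
    pathSection φ l x = interp φ p q x := by
  have hlt := h.lt_of_infix hpq
  have := pathSection_eq_of_mem_segment h hpq (interp_mem_segment hlt h₁ h₂)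
  rwa [apply_interp_self hlt] at this

theorem exists_infix_between {l : List E} (h : IsIncreasing φ l) {a b : E} (ha : a ∈ l)
    (hb : b ∈ l) (hab : φ a < φ b) {x : ℝ} (hax : φ a ≤ x) (hxb : x ≤ φ b) :
    ∃ p q, [p, q] <:+: l ∧ φ p ≤ x ∧ x ≤ φ q := by
  induction l generalizing a with
  | nil => simp at ha
  | cons p l ih =>
    cases l with
    | nil =>
      rw [List.mem_singleton] at ha hb
      subst ha hb
      exact absurd hab (lt_irrefl _)
    | cons q l =>
      have hpq : φ p < φ q := List.rel_of_pairwise_cons h (by simp)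
      by_cases hx : x ≤ φ q
      · refine ⟨p, q, ⟨[], l, by simp⟩, ?_, hx⟩
        rcases List.mem_cons.1 ha with rfl | ha
        · exact hax
        · exact (List.rel_of_pairwise_cons h ha).le.trans hax
      · rw [not_le] at hx
        have hb' : b ∈ q :: l := by
          rcases List.mem_cons.1 hb with rfl | hb
          · linarith
          · exact hb
        obtain ⟨p', q', hinf, h'⟩ := ih h.of_cons (a := q) (by simp) hb' (hx.trans_le hxb) hx.le
        exact ⟨p', q', List.infix_cons_iff.2 (Or.inr hinf), h'⟩

theorem IsIncreasing.le_or_le_of_infix {l : List E} (h : IsIncreasing φ l) {p q r : E}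
    (hpq : [p, q] <:+: l) (hr : r ∈ l) : φ r ≤ φ p ∨ φ q ≤ φ r := by
  obtain ⟨s, t, rfl⟩ := hpq
  simp only [IsIncreasing, List.pairwise_append, List.mem_append, List.mem_cons,
    List.not_mem_nil, or_false] at h hr
  rcases hr with (hr | rfl | rfl) | hr
  · exact Or.inl (h.1.2.2 r hr p (Or.inl rfl)).le
  · exact Or.inl le_rfl
  · exact Or.inr le_rfl
  · exact Or.inr (h.2.2 q (Or.inr (Or.inr rfl)) r hr).le

theorem pathSection_of_mem {l : List E} (h : IsIncreasing φ l) {r : E} (hr : r ∈ l) :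
    pathSection φ l (φ r) = r := by
  induction l with
  | nil => simp at hr
  | cons p l ih =>
    rcases List.mem_cons.1 hr with rfl | hr'
    · exact pathSection_head h
    · cases l with
      | nil => simp at hr'
      | cons q l =>
        rw [pathSection]
        split_ifs with hx
        · rcases List.mem_cons.1 hr' with rfl | hr''
          · exact interp_right (List.rel_of_pairwise_cons h (by simp))
          · exact absurd hx (List.rel_of_pairwise_cons h.of_cons hr'').not_ge
        · exact ih h.of_cons hr'

theorem exists_isIncreasing {V : Set E} (hV : V.Finite) (hinj : Set.InjOn φ V) :
    ∃ l : List E, IsIncreasing φ l ∧ ∀ p, p ∈ l ↔ p ∈ V := by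
  classical
  let r : E → E → Prop := fun p q => φ p ≤ φ q
  have : Std.Total r := ⟨fun p q => le_total _ _⟩
  have : IsTrans E r := ⟨fun p q s => le_trans⟩
  let l := hV.toFinset.toList.insertionSort r
  have hmem : ∀ p, p ∈ l ↔ p ∈ V := fun p => by simp [l]
  have hnd : l.Nodup := (List.perm_insertionSort r _).nodup_iff.2 (Finset.nodup_toList _)
  refine ⟨l, ?_, hmem⟩
  refine ((List.pairwise_insertionSort r _).and hnd).imp_of_mem ?_
  rintro p q hp hq ⟨hle, hne⟩
  exact lt_of_le_of_ne hle fun he => hne (hinj ((hmem p).1 hp) ((hmem q).1 hq) he)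

theorem IsIncreasing.nodup {l : List E} (h : IsIncreasing φ l) : l.Nodup :=
  h.imp fun hlt he => by subst he; exact lt_irrefl _ hlt

theorem IsIncreasing.eq_of_mem_iff {l l' : List E} (h : IsIncreasing φ l)
    (h' : IsIncreasing φ l') (hm : ∀ p, p ∈ l ↔ p ∈ l') : l = l' :=
  List.Perm.eq_of_pairwise (fun _ _ _ _ h₁ h₂ => absurd h₁ h₂.not_gt) h h'
    ((List.perm_ext_iff_of_nodup h.nodup h'.nodup).2 hm)

end PathSection

section Averages

variable {E : Type*} [NormedAddCommGroup E] [NormedSpace ℝ E] {a b : ℝ}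

theorem apply_setAverage_Icc [CompleteSpace E] (c : E →L[ℝ] ℝ) {s : ℝ → E}
    (hs : ContinuousOn s (Set.Icc a b)) :
    c (⨍ x in Set.Icc a b, s x) = ⨍ x in Set.Icc a b, c (s x) := by
  rw [setAverage_eq, setAverage_eq, map_smul, c.integral_comp_comm]
  exact hs.integrableOn_Icc

theorem setAverage_Icc_le {f g : ℝ → ℝ} (hf : ContinuousOn f (Set.Icc a b))
    (hg : ContinuousOn g (Set.Icc a b)) (h : ∀ x ∈ Set.Icc a b, f x ≤ g x) :
    ⨍ x in Set.Icc a b, f x ≤ ⨍ x in Set.Icc a b, g x := by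
  rw [setAverage_eq, setAverage_eq, smul_eq_mul, smul_eq_mul]
  exact mul_le_mul_of_nonneg_left
    (setIntegral_mono_on hf.integrableOn_Icc hg.integrableOn_Icc measurableSet_Icc h)
    (inv_nonneg.2 measureReal_nonneg)

theorem eq_of_setAverage_Icc_eq (hab : a < b) {f g : ℝ → ℝ} (hf : ContinuousOn f (Set.Icc a b))
    (hg : ContinuousOn g (Set.Icc a b)) (h : ∀ x ∈ Set.Icc a b, f x ≤ g x)
    (he : ⨍ x in Set.Icc a b, f x = ⨍ x in Set.Icc a b, g x) {x : ℝ} (hx : x ∈ Set.Icc a b) :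
    f x = g x := by
  by_contra hne
  have hlt := intervalIntegral.integral_lt_integral_of_continuousOn_of_le_of_exists_lt hab hf hg
    (fun y hy => h y (Set.Ioc_subset_Icc_self hy)) ⟨x, hx, lt_of_le_of_ne (h x hx) hne⟩
  rw [intervalIntegral.integral_of_le hab.le, intervalIntegral.integral_of_le hab.le,
    ← integral_Icc_eq_integral_Ioc, ← integral_Icc_eq_integral_Ioc] at hlt
  rw [setAverage_eq, setAverage_eq, smul_eq_mul, smul_eq_mul] at he
  have hv : (volume.real (Set.Icc a b))⁻¹ ≠ 0 := by
    rw [Real.volume_real_Icc_of_le hab.le]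
    exact inv_ne_zero (sub_pos.2 hab).ne'
  exact hlt.ne (mul_left_cancel₀ hv he)

end Averages

section ConvexHull

variable {E : Type*} [NormedAddCommGroup E] [NormedSpace ℝ E]

theorem apply_le_of_mem_convexHull {X : Set E} (c : E →L[ℝ] ℝ) {μ : ℝ} (h : ∀ x ∈ X, c x ≤ μ)
    {y : E} (hy : y ∈ convexHull ℝ X) : c y ≤ μ :=
  convexHull_min (t := {y | c y ≤ μ}) h (convex_halfSpace_le c.toLinearMap.isLinear μ) hy

theorem le_apply_of_mem_convexHull {X : Set E} (c : E →L[ℝ] ℝ) {μ : ℝ} (h : ∀ x ∈ X, μ ≤ c x)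
    {y : E} (hy : y ∈ convexHull ℝ X) : μ ≤ c y :=
  convexHull_min (t := {y | μ ≤ c y}) h (convex_halfSpace_ge c.toLinearMap.isLinear μ) hy

/-- A point of the convex hull of `X` where a functional attains its upper bound on `X` is in the
convex hull of the points of `X` where this bound is attained. -/
theorem mem_convexHull_of_apply_eq {X : Set E} (c : E →L[ℝ] ℝ) {μ : ℝ} (h : ∀ x ∈ X, c x ≤ μ)
    {y : E} (hy : y ∈ convexHull ℝ X) (hyc : c y = μ) :
    y ∈ convexHull ℝ {x ∈ X | c x = μ} := by
  suffices H : convexHull ℝ X ⊆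
      {y | c y ≤ μ ∧ (c y = μ → y ∈ convexHull ℝ {x ∈ X | c x = μ})} from (H hy).2 hyc
  refine convexHull_min (fun x hx => ⟨h x hx, fun hxc => subset_convexHull ℝ _ ⟨hx, hxc⟩⟩) ?_
  refine convex_iff_forall_pos.2 ?_
  intro x hx z hz s t hs ht hst
  have hval : c (s • x + t • z) = s * c x + t * c z := by simp
  refine ⟨?_, fun heq => ?_⟩
  · rw [hval]
    obtain rfl : s = 1 - t := by linarith
    nlinarith [hx.1, hz.1]
  · rw [hval] at heq
    have h₁ : 0 ≤ s * (μ - c x) := mul_nonneg hs.le (sub_nonneg.2 hx.1)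
    have h₂ : 0 ≤ t * (μ - c z) := mul_nonneg ht.le (sub_nonneg.2 hz.1)
    have h₃ : s * (μ - c x) + t * (μ - c z) = 0 := by
      have : s * μ + t * μ = μ := by rw [← add_mul, hst, one_mul]
      linarith
    have hx' : μ - c x = 0 := (mul_eq_zero.1 (by linarith : s * (μ - c x) = 0)).resolve_left hs.ne'
    have hz' : μ - c z = 0 := (mul_eq_zero.1 (by linarith : t * (μ - c z) = 0)).resolve_left ht.ne'
    exact convex_convexHull ℝ _ (hx.2 (by linarith)) (hz.2 (by linarith)) hs.le ht.le hst

theorem exists_apply_le_of_mem_convexHull {X : Set E} (hX : X.Finite) (c : E →L[ℝ] ℝ)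
    (hne : X.Nonempty) :
    ∃ r ∈ X, ∀ y ∈ convexHull ℝ X, c y ≤ c r := by
  obtain ⟨r, hr, hmax⟩ := Set.exists_max_image X c hX hne
  exact ⟨r, hr, fun y hy => apply_le_of_mem_convexHull c hmax hy⟩

/-- The faces of a convex hull. -/
theorem setOf_isMax_convexHull {X : Set E} (c : E →L[ℝ] ℝ) {x₀ : E} (hx₀ : x₀ ∈ X)
    (h : ∀ x ∈ X, c x ≤ c x₀) :
    {x | x ∈ convexHull ℝ X ∧ ∀ y ∈ convexHull ℝ X, c y ≤ c x} =
      convexHull ℝ {x ∈ X | c x = c x₀} := by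
  refine Set.Subset.antisymm ?_ ?_
  · rintro x ⟨hx, hmax⟩
    exact mem_convexHull_of_apply_eq c h hx
      (le_antisymm (apply_le_of_mem_convexHull c h hx) (hmax _ (subset_convexHull ℝ _ hx₀)))
  · intro x hx
    refine ⟨convexHull_mono (Set.sep_subset _ _) hx, fun y hy => ?_⟩
    have h₁ : c y ≤ c x₀ := apply_le_of_mem_convexHull c h hy
    have h₂ : (-c) x ≤ -c x₀ :=
      apply_le_of_mem_convexHull (-c) (fun z hz => by simp [hz.2]) hx
    simp only [neg_apply, neg_le_neg_iff] at h₂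
    exact h₁.trans h₂

theorem left_mem_extremePoints_segment {p q : E} : p ∈ Set.extremePoints ℝ (segment ℝ p q) := by
  by_cases hpq : p = q
  · subst hpq
    simp
  rw [mem_extremePoints_iff_left]
  refine ⟨left_mem_segment ℝ p q, ?_⟩
  rintro x hx y hy ⟨s, t, hs, ht, hst, h⟩
  rw [segment_eq_image_lineMap] at hx hy
  obtain ⟨u, ⟨hu, -⟩, rfl⟩ := hx
  obtain ⟨v, ⟨hv, -⟩, rfl⟩ := hy
  have key : (s * u + t * v) • (q - p) = 0 := by
    have h' : s • (AffineMap.lineMap p q u : E) + t • (AffineMap.lineMap p q v : E)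
        = (s + t) • p + (s * u + t * v) • (q - p) := by
      simp only [AffineMap.lineMap_apply_module']
      module
    rw [h', hst, one_smul] at h
    simpa using h
  have h0 := (smul_eq_zero.1 key).resolve_right (sub_ne_zero.2 (Ne.symm hpq))
  have : s * u = 0 := by nlinarith [mul_nonneg hs.le hu, mul_nonneg ht.le hv]
  rw [(mul_eq_zero.1 this).resolve_left hs.ne', AffineMap.lineMap_apply_zero]

theorem PolytopeAdj.mem_extremePoints {P : Set E} {p q : E} (h : PolytopeAdj P p q) :
    p ∈ Set.extremePoints ℝ P ∧ q ∈ Set.extremePoints ℝ P := by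
  have hsub := h.2.isExtreme.extremePoints_subset_extremePoints
  refine ⟨hsub left_mem_extremePoints_segment, hsub ?_⟩
  rw [segment_symm]
  exact left_mem_extremePoints_segment

end ConvexHull

section Optimal

variable {E : Type*} [NormedAddCommGroup E] [NormedSpace ℝ E] {φ : E →L[ℝ] ℝ} {W : Set E}

/-- The section along `l` maximizes `c` on every fiber of `φ` on the convex hull of `W`. -/
def IsOptimal (φ : E →L[ℝ] ℝ) (W : Set E) (c : E →L[ℝ] ℝ) (l : List E) : Prop :=
  ∀ y ∈ convexHull ℝ W, c y ≤ c (pathSection φ l (φ y))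

/-- The point `p` maximizes `c` on its fiber of `φ` on the convex hull of `W`. -/
def IsUpper (φ : E →L[ℝ] ℝ) (W : Set E) (c : E →L[ℝ] ℝ) (p : E) : Prop :=
  ∀ y ∈ convexHull ℝ W, φ y = φ p → c y ≤ c p

/-- `l` is a `φ`-increasing list of points of `W` from `bot` to `top`. -/
structure IsPath (φ : E →L[ℝ] ℝ) (W : Set E) (bot top : E) (l : List E) : Prop where
  increasing : IsIncreasing φ l
  subset : ∀ p ∈ l, p ∈ W
  bot_mem : bot ∈ l
  top_mem : top ∈ l

variable {bot top : E} {l : List E} {c : E →L[ℝ] ℝ}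

theorem IsPath.exists_infix (hl : IsPath φ W bot top l) (hlt : φ bot < φ top) {x : ℝ}
    (h₁ : φ bot ≤ x) (h₂ : x ≤ φ top) :
    ∃ p q, [p, q] <:+: l ∧ φ p ≤ x ∧ x ≤ φ q :=
  exists_infix_between hl.increasing hl.bot_mem hl.top_mem hlt h₁ h₂

theorem IsPath.pathSection_mem (hl : IsPath φ W bot top l) (hlt : φ bot < φ top) {x : ℝ}
    (h₁ : φ bot ≤ x) (h₂ : x ≤ φ top) :
    pathSection φ l x ∈ convexHull ℝ W ∧ φ (pathSection φ l x) = x := by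
  obtain ⟨p, q, hpq, hp, hq⟩ := hl.exists_infix hlt h₁ h₂
  have hpq' := hl.increasing.lt_of_infix hpq
  rw [pathSection_eq_interp hl.increasing hpq hp hq]
  exact ⟨segment_subset_convexHull (hl.subset _ (mem_of_pair_infix hpq).1)
    (hl.subset _ (mem_of_pair_infix hpq).2) (interp_mem_segment hpq' hp hq),
    apply_interp_self hpq' x⟩

theorem IsUpper.interp_le {r : E} (hr : IsUpper φ W c r) {p q : E} (hp : p ∈ convexHull ℝ W)
    (hq : q ∈ convexHull ℝ W) (hpr : φ p ≤ φ r) (hrq : φ r ≤ φ q) (hpq : φ p < φ q) :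
    c (interp φ p q (φ r)) ≤ c r :=
  hr _ ((convex_convexHull ℝ W).segment_subset hp hq (interp_mem_segment hpq hpr hrq))
    (apply_interp_self hpq _)

theorem isOptimal_of_supporting (hl : IsPath φ W bot top l) (hlt : φ bot < φ top)
    (hbot : ∀ r ∈ W, φ bot ≤ φ r) (htop : ∀ r ∈ W, φ r ≤ φ top)
    (h : ∀ p q, [p, q] <:+: l → ∃ α β : ℝ, (∀ r ∈ W, c r ≤ α + β * φ r) ∧
      c p = α + β * φ p ∧ c q = α + β * φ q) : IsOptimal φ W c l := by
  intro y hy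
  have h₁ : φ bot ≤ φ y := le_apply_of_mem_convexHull φ hbot hy
  have h₂ : φ y ≤ φ top := apply_le_of_mem_convexHull φ htop hy
  obtain ⟨p, q, hpq, hp, hq⟩ := hl.exists_infix hlt h₁ h₂
  obtain ⟨α, β, hW, hcp, hcq⟩ := h p q hpq
  rw [pathSection_eq_interp hl.increasing hpq hp hq,
    apply_interp_eq_affine (hl.increasing.lt_of_infix hpq) hcp hcq]
  have := apply_le_of_mem_convexHull (c - β • φ) (μ := α)
    (fun r hr => by simpa using hW r hr) hy
  simpa using this

theorem IsOptimal.isUpper (h : IsOptimal φ W c l) (hl : IsIncreasing φ l) {p : E} (hp : p ∈ l) :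
    IsUpper φ W c p := by
  intro y hy hyp
  have := h y hy
  rwa [hyp, pathSection_of_mem hl hp] at this

/-- Two points on the upper hull with no element of `W` on the upper hull between them span a
supporting line. -/
theorem exists_supporting (hW : W.Finite) {p q : E} (hpW : p ∈ W) (hqW : q ∈ W)
    (hp : IsUpper φ W c p) (hq : IsUpper φ W c q) (hpq : φ p < φ q)
    (h : ∀ r ∈ W, IsUpper φ W c r → φ r ≤ φ p ∨ φ q ≤ φ r) :
    ∃ α β : ℝ, (∀ r ∈ W, c r ≤ α + β * φ r) ∧ c p = α + β * φ p ∧ c q = α + β * φ q := by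
  have hne : φ q - φ p ≠ 0 := (sub_pos.2 hpq).ne'
  set β := (c q - c p) / (φ q - φ p) with hβ
  have hβ' : β * (φ q - φ p) = c q - c p := div_mul_cancel₀ _ hne
  have hpK := subset_convexHull ℝ W hpW
  have hqK := subset_convexHull ℝ W hqW
  obtain ⟨r, hr, hmax⟩ := exists_apply_le_of_mem_convexHull hW (c - β • φ) ⟨p, hpW⟩
  simp only [sub_apply, smul_apply, smul_eq_mul] at hmax
  have hrU : IsUpper φ W c r := by
    intro y hy hyr
    have := hmax y hy
    rw [hyr] at this
    linarith
  have hrK := subset_convexHull ℝ W hr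
  have key : c r - β * φ r ≤ c p - β * φ p := by
    by_contra hcon
    rw [not_le] at hcon
    rcases h r hr hrU with hle | hle
    · have hrq := hle.trans_lt hpq
      have h1 := hp.interp_le hrK hqK hle hpq.le hrq
      rw [apply_interp] at h1
      have h2 : 0 < φ q - φ r := sub_pos.2 hrq
      have h3 : (φ p - φ r) / (φ q - φ r) * (c q - c r) * (φ q - φ r)
          = (φ p - φ r) * (c q - c r) := by field_simp
      nlinarith
    · have hpr := hpq.trans_le hle
      have h1 := hq.interp_le hpK hrK hpq.le hle hpr
      rw [apply_interp] at h1
      have h2 : 0 < φ r - φ p := sub_pos.2 hpr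
      have h3 : (φ q - φ p) / (φ r - φ p) * (c r - c p) * (φ r - φ p)
          = (φ q - φ p) * (c r - c p) := by field_simp
      nlinarith
  refine ⟨c p - β * φ p, β, fun s hs => ?_, by ring, by linarith⟩
  have := hmax s (subset_convexHull ℝ W hs)
  linarith

/-- Adding points of the upper hull to an optimal path keeps it optimal. -/
theorem IsOptimal.refine {l' : List E} (h : IsOptimal φ W c l) (hl : IsPath φ W bot top l)
    (hl' : IsPath φ W bot top l') (hlt : φ bot < φ top)
    (hbot : ∀ r ∈ W, φ bot ≤ φ r) (htop : ∀ r ∈ W, φ r ≤ φ top)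
    (hsub : ∀ p ∈ l, p ∈ l') (hU : ∀ p ∈ l', IsUpper φ W c p) : IsOptimal φ W c l' := by
  intro y hy
  have h₁ : φ bot ≤ φ y := le_apply_of_mem_convexHull φ hbot hy
  have h₂ : φ y ≤ φ top := apply_le_of_mem_convexHull φ htop hy
  obtain ⟨p', q', hpq', hp', hq'⟩ := hl'.exists_infix hlt h₁ h₂
  have hlt' := hl'.increasing.lt_of_infix hpq'
  have hmem' := mem_of_pair_infix hpq'
  have hmid : φ p' < (φ p' + φ q') / 2 ∧ (φ p' + φ q') / 2 < φ q' := by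
    constructor <;> linarith
  obtain ⟨p, q, hpq, hp, hq⟩ := hl.exists_infix hlt
    ((hbot p' (hl'.subset _ hmem'.1)).trans hmid.1.le)
    (hmid.2.le.trans (htop q' (hl'.subset _ hmem'.2)))
  have hlt'' := hl.increasing.lt_of_infix hpq
  have hmem := mem_of_pair_infix hpq
  have hpp' : φ p ≤ φ p' := by
    rcases hl'.increasing.le_or_le_of_infix hpq' (hsub p hmem.1) with h | h <;> linarith
  have hqq' : φ q' ≤ φ q := by
    rcases hl'.increasing.le_or_le_of_infix hpq' (hsub q hmem.2) with h | h <;> linarith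
  have hval : ∀ r ∈ l', φ p ≤ φ r → φ r ≤ φ q → c r = c (interp φ p q (φ r)) := by
    intro r hr hpr hrq
    refine le_antisymm ?_ ?_
    · rw [← pathSection_eq_interp hl.increasing hpq hpr hrq]
      exact h r (subset_convexHull ℝ W (hl'.subset r hr))
    · exact (hU r hr).interp_le (subset_convexHull ℝ W (hl.subset p hmem.1))
        (subset_convexHull ℝ W (hl.subset q hmem.2)) hpr hrq hlt''
  set β := (c q - c p) / (φ q - φ p) with hβ
  have haff : ∀ x, c (interp φ p q x) = (c p - β * φ p) + β * x := fun x => by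
    rw [apply_interp, hβ]
    ring
  rw [pathSection_eq_interp hl'.increasing hpq' hp' hq',
    apply_interp_eq_affine (α := c p - β * φ p) (β := β) hlt', ← haff,
    ← pathSection_eq_interp hl.increasing hpq (hpp'.trans hp') (hq'.trans hqq')]
  · exact h y hy
  · rw [← haff]
    exact hval p' hmem'.1 hpp' (hlt'.le.trans hqq')
  · rw [← haff]
    exact hval q' hmem'.2 (hpp'.trans hlt'.le) hqq'

end Optimal

section CrossPolytope

variable {n : ℕ}

/-- The vertices `±eᵢ` of the cross-polytope. -/
def crossVertices (n : ℕ) : Set (EuclideanSpace ℝ (Fin n)) :=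
  {v | ∃ i : Fin n, v = stdVec i ∨ v = -stdVec i}

theorem crossPolytope_eq : crossPolytope n = convexHull ℝ (crossVertices n) := rfl

theorem stdVec_mem_crossVertices (i : Fin n) : stdVec i ∈ crossVertices n := ⟨i, Or.inl rfl⟩

theorem neg_mem_crossVertices {r : EuclideanSpace ℝ (Fin n)} (h : r ∈ crossVertices n) :
    -r ∈ crossVertices n := by
  rcases h with ⟨i, rfl | rfl⟩
  · exact ⟨i, Or.inr rfl⟩
  · exact ⟨i, Or.inl (neg_neg _)⟩

theorem finite_crossVertices : (crossVertices n).Finite := by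
  have : crossVertices n = Set.range stdVec ∪ Set.range fun i : Fin n => -stdVec i := by
    ext v
    simp only [crossVertices, Set.mem_ofPred_eq, Set.mem_union, Set.mem_range, exists_or, eq_comm]
  rw [this]
  exact (Set.finite_range _).union (Set.finite_range _)

theorem inner_stdVec (i j : Fin n) :
    inner ℝ (stdVec i) (stdVec j : EuclideanSpace ℝ (Fin n)) = if i = j then 1 else 0 := by
  simp [stdVec, EuclideanSpace.inner_single_left]

theorem stdVec_injective : Function.Injective (stdVec : Fin n → EuclideanSpace ℝ (Fin n)) := by
  intro i j h
  by_contra hne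
  have := inner_stdVec i j
  rw [← h, inner_stdVec, if_pos rfl, if_neg hne] at this
  norm_num at this

theorem stdVec_ne_neg_stdVec (i j : Fin n) :
    (stdVec i : EuclideanSpace ℝ (Fin n)) ≠ -stdVec j := by
  intro h
  have h1 := inner_stdVec i i
  nth_rewrite 2 [h] at h1
  rw [inner_neg_right, inner_stdVec, if_pos rfl] at h1
  split_ifs at h1 <;> norm_num at h1

theorem inner_self_of_mem {r : EuclideanSpace ℝ (Fin n)} (h : r ∈ crossVertices n) :
    inner ℝ r r = 1 := by
  rcases h with ⟨i, rfl | rfl⟩ 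
  · rw [inner_stdVec, if_pos rfl]
  · rw [inner_neg_neg, inner_stdVec, if_pos rfl]

theorem inner_eq_zero_of_mem {r s : EuclideanSpace ℝ (Fin n)} (hr : r ∈ crossVertices n)
    (hs : s ∈ crossVertices n) (h₁ : r ≠ s) (h₂ : r ≠ -s) : inner ℝ r s = 0 := by
  rcases hr with ⟨i, rfl | rfl⟩ <;> rcases hs with ⟨j, rfl | rfl⟩ <;>
  · have hij : i ≠ j := by
      rintro rfl
      simp at h₁ h₂
    simp [inner_stdVec, hij]

theorem exists_functional (h : Fin n → ℝ) :
    ∃ c : EuclideanSpace ℝ (Fin n) →L[ℝ] ℝ, ∀ i, c (stdVec i) = h i :=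
  ⟨innerSL ℝ (WithLp.toLp 2 h), fun i => by simp [stdVec, EuclideanSpace.inner_single_right]⟩

theorem polytopeAdj_crossPolytope {p q : EuclideanSpace ℝ (Fin n)} (hp : p ∈ crossVertices n)
    (hq : q ∈ crossVertices n) (h₁ : p ≠ q) (h₂ : p ≠ -q) :
    PolytopeAdj (crossPolytope n) p q := by
  refine ⟨h₁, fun _ => ⟨innerSL ℝ (p + q), ?_⟩⟩
  have hpq := inner_eq_zero_of_mem hp hq h₁ h₂
  have hqp : inner ℝ q p = 0 := by rw [real_inner_comm, hpq]
  have hcp : innerSL ℝ (p + q) p = 1 := by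
    rw [innerSL_apply_apply, inner_add_left, inner_self_of_mem hp, hqp, add_zero]
  have hcq : innerSL ℝ (p + q) q = 1 := by
    rw [innerSL_apply_apply, inner_add_left, inner_self_of_mem hq, hpq, zero_add]
  have hc : ∀ r ∈ crossVertices n, r ≠ p → r ≠ q → innerSL ℝ (p + q) r ≤ 0 := by
    intro r hr hrp hrq
    have aux : ∀ s ∈ crossVertices n, r ≠ s → inner ℝ s r ≤ 0 := by
      intro s hs hrs
      by_cases h : s = -r
      · rw [h, inner_neg_left, inner_self_of_mem hr]
        norm_num
      · exact (inner_eq_zero_of_mem hs hr hrs.symm h).le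
    simp only [innerSL_apply_apply, inner_add_left]
    linarith [aux p hp hrp, aux q hq hrq]
  rw [crossPolytope_eq, setOf_isMax_convexHull _ hp, hcp, ← convexHull_pair]
  · congr 1
    ext r
    simp only [Set.mem_insert_iff, Set.mem_singleton_iff, Set.mem_ofPred_eq]
    constructor
    · rintro (rfl | rfl)
      · exact ⟨hp, hcp⟩
      · exact ⟨hq, hcq⟩
    · rintro ⟨hr, hr1⟩
      by_contra hcon
      rw [not_or] at hcon
      linarith [hc r hr hcon.1 hcon.2]
  · intro r hr
    rw [hcp]
    by_cases h1 : r = p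
    · rw [h1, hcp]
    by_cases h2 : r = q
    · rw [h2, hcq]
    linarith [hc r hr h1 h2]

theorem exists_mem_crossVertices_ne (hn : 2 ≤ n) {p : EuclideanSpace ℝ (Fin n)}
    (hp : p ∈ crossVertices n) : ∃ q ∈ crossVertices n, p ≠ q ∧ p ≠ -q := by
  have : Nontrivial (Fin n) := Fin.nontrivial_iff_two_le.2 hn
  rcases hp with ⟨i, rfl | rfl⟩ <;> obtain ⟨j, hj⟩ := exists_ne i <;>
  refine ⟨stdVec j, stdVec_mem_crossVertices j, ?_, ?_⟩
  · exact fun h => hj (stdVec_injective h).symm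
  · exact stdVec_ne_neg_stdVec i j
  · exact (stdVec_ne_neg_stdVec j i).symm
  · exact fun h => hj (stdVec_injective (neg_injective h)).symm

theorem extremePoints_crossPolytope (hn : 2 ≤ n) :
    Set.extremePoints ℝ (crossPolytope n) = crossVertices n := by
  refine Set.Subset.antisymm extremePoints_convexHull_subset fun p hp => ?_
  obtain ⟨q, hq, h₁, h₂⟩ := exists_mem_crossVertices_ne hn hp
  exact (polytopeAdj_crossPolytope hp hq h₁ h₂).mem_extremePoints.1

/-- Antipodal vertices of the cross-polytope are not adjacent. -/
theorem not_polytopeAdj_neg (hn : 2 ≤ n) {p : EuclideanSpace ℝ (Fin n)}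
    (hp : p ∈ crossVertices n) : ¬ PolytopeAdj (crossPolytope n) (-p) p := by
  rintro ⟨-, h⟩
  obtain ⟨c, hc⟩ := h ⟨p, right_mem_segment ℝ _ _⟩
  obtain ⟨q, hq, h₁, h₂⟩ := exists_mem_crossVertices_ne hn hp
  have hpq := inner_eq_zero_of_mem hp hq h₁ h₂
  have h0 : (0 : EuclideanSpace ℝ (Fin n)) ∈ segment ℝ (-p) p :=
    ⟨1 / 2, 1 / 2, by norm_num, by norm_num, by norm_num, by simp⟩
  rw [hc] at h0
  have hK : ∀ r ∈ crossVertices n, r ∈ crossPolytope n := fun r hr => subset_convexHull ℝ _ hr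
  have hle : ∀ r ∈ crossVertices n, c r ≤ 0 := fun r hr => by simpa using h0.2 r (hK r hr)
  have hq0 : c q = 0 := by
    have := hle _ (neg_mem_crossVertices hq)
    rw [map_neg] at this
    linarith [hle q hq]
  have hqs : q ∈ segment ℝ (-p) p := by
    rw [hc]
    refine ⟨hK q hq, fun y hy => ?_⟩
    rw [hq0]
    exact apply_le_of_mem_convexHull c hle hy
  obtain ⟨a, b, -, -, -, hab⟩ := hqs
  have h1 := inner_self_of_mem hq
  nth_rewrite 1 [← hab] at h1
  simp [inner_add_left, inner_smul_left, hpq] at h1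

/-- The data of a generic functional on the cross-polytope with its maximal vertex `top`. -/
structure IsFrame (φ : EuclideanSpace ℝ (Fin n) →L[ℝ] ℝ) (m : Fin n)
    (top : EuclideanSpace ℝ (Fin n)) : Prop where
  inj : Set.InjOn φ (crossVertices n)
  top_eq : top = stdVec m ∨ top = -stdVec m
  pos : 0 < φ top
  le_top : ∀ r ∈ crossVertices n, φ r ≤ φ top

theorem exists_isFrame {φ : EuclideanSpace ℝ (Fin n) →L[ℝ] ℝ} {m : Fin n}
    (hinj : Set.InjOn φ (crossVertices n)) (hm : ∀ i : Fin n, |φ (stdVec i)| ≤ |φ (stdVec m)|) :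
    ∃ top, IsFrame φ m top := by
  have hle : ∀ r ∈ crossVertices n, φ r ≤ |φ (stdVec m)| := by
    rintro r ⟨i, rfl | rfl⟩
    · exact (le_abs_self _).trans (hm i)
    · rw [map_neg]
      exact (neg_le_abs _).trans (hm i)
  have h0 : φ (stdVec m) ≠ 0 := fun h =>
    stdVec_ne_neg_stdVec m m (hinj (stdVec_mem_crossVertices m)
      (neg_mem_crossVertices (stdVec_mem_crossVertices m)) (by rw [map_neg, h, neg_zero]))
  rcases lt_or_gt_of_ne h0 with h | h
  · rw [abs_of_neg h] at hle
    exact ⟨-stdVec m, hinj, Or.inr rfl, by rw [map_neg]; linarith, by simpa using hle⟩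
  · rw [abs_of_pos h] at hle
    exact ⟨stdVec m, hinj, Or.inl rfl, h, hle⟩

variable {φ : EuclideanSpace ℝ (Fin n) →L[ℝ] ℝ} {m : Fin n} {top : EuclideanSpace ℝ (Fin n)}

theorem IsFrame.top_mem (F : IsFrame φ m top) : top ∈ crossVertices n := ⟨m, F.top_eq⟩

theorem IsFrame.neg_top_mem (F : IsFrame φ m top) : -top ∈ crossVertices n :=
  neg_mem_crossVertices F.top_mem

theorem IsFrame.neg_top_le (F : IsFrame φ m top) :
    ∀ r ∈ crossVertices n, φ (-top) ≤ φ r := fun r hr => by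
  have := F.le_top _ (neg_mem_crossVertices hr)
  rw [map_neg] at this ⊢
  linarith

theorem IsFrame.lt (F : IsFrame φ m top) : φ (-top) < φ top := by
  rw [map_neg]
  linarith [F.pos]

theorem IsFrame.image_eq (F : IsFrame φ m top) :
    φ '' crossPolytope n = Set.Icc (φ (-top)) (φ top) := by
  refine Set.Subset.antisymm ?_ fun x hx => ?_
  · rintro _ ⟨y, hy, rfl⟩
    exact ⟨le_apply_of_mem_convexHull φ F.neg_top_le hy,
      apply_le_of_mem_convexHull φ F.le_top hy⟩
  · exact ⟨interp φ (-top) top x, segment_subset_convexHull F.neg_top_mem F.top_mem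
      (interp_mem_segment F.lt hx.1 hx.2), apply_interp_self F.lt x⟩

theorem IsFrame.isUpper_top (F : IsFrame φ m top) (c : EuclideanSpace ℝ (Fin n) →L[ℝ] ℝ) :
    IsUpper φ (crossVertices n) c top := by
  intro y hy hyt
  have h := mem_convexHull_of_apply_eq φ F.le_top hy hyt
  refine apply_le_of_mem_convexHull c ?_ h
  rintro r ⟨hr, hrt⟩
  rw [F.inj hr F.top_mem hrt]

theorem IsFrame.isUpper_neg_top (F : IsFrame φ m top) (c : EuclideanSpace ℝ (Fin n) →L[ℝ] ℝ) :
    IsUpper φ (crossVertices n) c (-top) := by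
  intro y hy hyt
  have h := mem_convexHull_of_apply_eq (-φ) (μ := -φ (-top))
    (fun r hr => neg_le_neg (F.neg_top_le r hr)) hy (congrArg Neg.neg hyt)
  refine apply_le_of_mem_convexHull c ?_ h
  rintro r ⟨hr, hrt⟩
  rw [F.inj hr F.neg_top_mem (neg_injective hrt)]

/-- If `c` is a multiple of `φ`, then every path is optimal. -/
theorem IsFrame.isOptimal_of_eq_mul (F : IsFrame φ m top)
    {c : EuclideanSpace ℝ (Fin n) →L[ℝ] ℝ} {β : ℝ} (h : ∀ r ∈ crossVertices n, c r = β * φ r)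
    {l : List (EuclideanSpace ℝ (Fin n))} (hl : IsPath φ (crossVertices n) (-top) top l) :
    IsOptimal φ (crossVertices n) c l := by
  refine isOptimal_of_supporting hl F.lt F.neg_top_le F.le_top fun p q hpq => ⟨0, β, ?_, ?_, ?_⟩
  · exact fun r hr => by rw [h r hr, zero_add]
  · rw [h p (hl.subset p (mem_of_pair_infix hpq).1), zero_add]
  · rw [h q (hl.subset q (mem_of_pair_infix hpq).2), zero_add]

theorem eq_mul_of_le_mul {c : EuclideanSpace ℝ (Fin n) →L[ℝ] ℝ} {β : ℝ}
    (h : ∀ r ∈ crossVertices n, c r ≤ β * φ r) : ∀ r ∈ crossVertices n, c r = β * φ r := by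
  intro r hr
  have := h _ (neg_mem_crossVertices hr)
  rw [map_neg, map_neg] at this
  linarith [h r hr]

theorem IsFrame.apply_interp_top (F : IsFrame φ m top)
    (c : EuclideanSpace ℝ (Fin n) →L[ℝ] ℝ) (x : ℝ) :
    c (interp φ (-top) top x) = c top / φ top * x := by
  have := F.pos.ne'
  rw [apply_interp_eq_affine (α := 0) (β := c top / φ top) F.lt, zero_add] 
  · simp only [map_neg]
    field_simp
    ring
  · field_simp
    ring

/-- If antipodal vertices are both on the upper hull, then `c` is a multiple of `φ`. -/
theorem IsFrame.eq_mul_of_isUpper (F : IsFrame φ m top)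
    {c : EuclideanSpace ℝ (Fin n) →L[ℝ] ℝ} {w : EuclideanSpace ℝ (Fin n)}
    (hw : w ∈ crossVertices n) (hwt : w ≠ top) (hwb : w ≠ -top)
    (h : IsUpper φ (crossVertices n) c w) (h' : IsUpper φ (crossVertices n) c (-w)) :
    ∀ r ∈ crossVertices n, c r = c top / φ top * φ r := by
  have hK := subset_convexHull ℝ (crossVertices n)
  have hw' := neg_mem_crossVertices hw
  have h1 := h.interp_le (hK F.neg_top_mem) (hK F.top_mem) (F.neg_top_le w hw) (F.le_top w hw) F.lt
  have h2 := h'.interp_le (hK F.neg_top_mem) (hK F.top_mem) (F.neg_top_le _ hw') (F.le_top _ hw')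
    F.lt
  rw [F.apply_interp_top] at h1 h2
  rw [map_neg, map_neg] at h2
  have hcw : c w = c top / φ top * φ w := by linarith
  have hwt' : φ w < φ top := lt_of_le_of_ne (F.le_top w hw) fun e => hwt (F.inj hw F.top_mem e)
  have hwb' : φ (-top) < φ w :=
    lt_of_le_of_ne (F.neg_top_le w hw) fun e => hwb (F.inj hw F.neg_top_mem e.symm)
  have hct : c top = c top / φ top * φ top := (div_mul_cancel₀ _ F.pos.ne').symm
  have hcb : c (-top) = c top / φ top * φ (-top) := by
    rw [map_neg, map_neg]
    linarith
  set β := c top / φ top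
  refine eq_mul_of_le_mul fun r hr => ?_
  by_contra hcon
  rw [not_le] at hcon
  rcases lt_trichotomy (φ r) (φ w) with hlt | heq | hgt
  · have hrt := hlt.trans hwt'
    have h3 := h.interp_le (hK hr) (hK F.top_mem) hlt.le hwt'.le hrt
    rw [apply_interp] at h3
    have h4 : (φ w - φ r) / (φ top - φ r) * (c top - c r) * (φ top - φ r)
        = (φ w - φ r) * (c top - c r) := by
      have : φ top - φ r ≠ 0 := (sub_pos.2 hrt).ne'
      field_simp
    nlinarith [sub_pos.2 hrt]
  · rw [F.inj hr hw heq] at hcon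
    linarith
  · have hrt := hwb'.trans hgt
    have h3 := h.interp_le (hK F.neg_top_mem) (hK hr) hwb'.le hgt.le hrt
    rw [apply_interp] at h3
    have h4 : (φ w - φ (-top)) / (φ r - φ (-top)) * (c r - c (-top)) * (φ r - φ (-top))
        = (φ w - φ (-top)) * (c r - c (-top)) := by
      have : φ r - φ (-top) ≠ 0 := (sub_pos.2 hrt).ne'
      field_simp
    nlinarith [sub_pos.2 hrt]

end CrossPolytope

section SignVectors

variable {n : ℕ}

/-- The vertex `ε eᵢ` of the cross-polytope (zero if `ε = 0`). -/
noncomputable def signVertex (i : Fin n) (ε : SignType) : EuclideanSpace ℝ (Fin n) :=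
  (ε : ℝ) • stdVec i

@[simp] theorem signVertex_one (i : Fin n) : signVertex i 1 = stdVec i := by simp [signVertex]

@[simp] theorem signVertex_neg_one (i : Fin n) : signVertex i (-1) = -stdVec i := by
  simp [signVertex]

theorem neg_signVertex (i : Fin n) (ε : SignType) : -signVertex i ε = signVertex i (-ε) := by
  cases ε <;> simp [signVertex]

theorem SignType.eq_one_or_neg_one {ε : SignType} (h : ε ≠ 0) : ε = 1 ∨ ε = -1 := by
  revert ε
  decide

theorem mem_crossVertices_iff {r : EuclideanSpace ℝ (Fin n)} :
    r ∈ crossVertices n ↔ ∃ i ε, ε ≠ 0 ∧ r = signVertex i ε := by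
  constructor
  · rintro ⟨i, rfl | rfl⟩
    · exact ⟨i, 1, by decide, (signVertex_one i).symm⟩
    · exact ⟨i, -1, by decide, (signVertex_neg_one i).symm⟩
  · rintro ⟨i, ε, hε, rfl⟩
    rcases SignType.eq_one_or_neg_one hε with rfl | rfl
    · exact ⟨i, Or.inl (signVertex_one i)⟩
    · exact ⟨i, Or.inr (signVertex_neg_one i)⟩

theorem signVertex_mem_crossVertices (i : Fin n) {ε : SignType} (h : ε ≠ 0) :
    signVertex i ε ∈ crossVertices n := mem_crossVertices_iff.2 ⟨i, ε, h, rfl⟩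

theorem signVertex_inj {i j : Fin n} {ε δ : SignType} (hε : ε ≠ 0) (hδ : δ ≠ 0) :
    signVertex i ε = signVertex j δ ↔ i = j ∧ ε = δ := by
  refine ⟨fun h => ?_, by rintro ⟨rfl, rfl⟩; rfl⟩
  rcases SignType.eq_one_or_neg_one hε with rfl | rfl <;>
  rcases SignType.eq_one_or_neg_one hδ with rfl | rfl <;>
  simp only [signVertex_one, signVertex_neg_one] at h
  · exact ⟨stdVec_injective h, rfl⟩
  · exact absurd h (stdVec_ne_neg_stdVec i j)
  · exact absurd h.symm (stdVec_ne_neg_stdVec j i)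
  · exact ⟨stdVec_injective (neg_injective h), rfl⟩

variable {m : Fin n}

/-- The vertices on the monotone path with sign vector `σ`. -/
def signVertices (m : Fin n) (σ : {i : Fin n // i ≠ m} → SignType) :
    Set (EuclideanSpace ℝ (Fin n)) :=
  {p | (p = stdVec m ∨ p = -stdVec m) ∨ ∃ i, σ i ≠ 0 ∧ p = signVertex i.1 (σ i)}

variable {σ τ : {i : Fin n // i ≠ m} → SignType}

theorem signVertices_subset : signVertices m σ ⊆ crossVertices n := by
  rintro p ((rfl | rfl) | ⟨i, hi, rfl⟩)
  · exact stdVec_mem_crossVertices m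
  · exact neg_mem_crossVertices (stdVec_mem_crossVertices m)
  · exact signVertex_mem_crossVertices _ hi

theorem signVertex_mem_signVertices (i : {i : Fin n // i ≠ m}) {ε : SignType} (hε : ε ≠ 0) :
    signVertex i.1 ε ∈ signVertices m σ ↔ σ i = ε := by
  constructor
  · rintro ((h | h) | ⟨j, hj, h⟩)
    · rw [← signVertex_one, signVertex_inj hε (by decide)] at h
      exact absurd h.1 i.2
    · rw [← signVertex_neg_one, signVertex_inj hε (by decide)] at h
      exact absurd h.1 i.2
    · obtain ⟨h₁, h₂⟩ := (signVertex_inj hε hj).1 h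
      rw [Subtype.ext h₁, h₂]
  · rintro rfl
    exact Or.inr ⟨i, hε, rfl⟩

theorem signVertices_injective (h : signVertices m σ = signVertices m τ) : σ = τ := by
  have key : ∀ i (ε : SignType), ε ≠ 0 → (σ i = ε ↔ τ i = ε) := fun i ε hε => by
    rw [← signVertex_mem_signVertices i hε, ← signVertex_mem_signVertices i hε, h]
  funext i
  have h₁ := key i 1 (by decide)
  have h₂ := key i (-1) (by decide)
  revert h₁ h₂
  generalize σ i = a
  generalize τ i = b
  revert a b
  decide

theorem signVertices_update (i : {i : Fin n // i ≠ m}) (hi : τ i = 0) {ε : SignType}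
    (hε : ε ≠ 0) :
    signVertices m (Function.update τ i ε) = insert (signVertex i.1 ε) (signVertices m τ) := by
  ext p
  constructor
  · rintro (h | ⟨j, hj, rfl⟩)
    · exact Or.inr (Or.inl h)
    · by_cases hji : j = i
      · subst hji
        left
        rw [Function.update_self]
      · rw [Function.update_of_ne hji] at hj ⊢
        exact Or.inr (Or.inr ⟨j, hj, rfl⟩)
  · rintro (rfl | h | ⟨j, hj, rfl⟩)
    · exact (signVertex_mem_signVertices i hε).2 (Function.update_self ..)
    · exact Or.inl h
    · have hji : j ≠ i := by
        rintro rfl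
        exact hj hi
      exact Or.inr ⟨j, by rwa [Function.update_of_ne hji], by rw [Function.update_of_ne hji]⟩

variable {φ : EuclideanSpace ℝ (Fin n) →L[ℝ] ℝ} {top : EuclideanSpace ℝ (Fin n)}

theorem IsFrame.top_mem_signVertices (F : IsFrame φ m top) : top ∈ signVertices m σ :=
  Or.inl F.top_eq

theorem IsFrame.neg_top_mem_signVertices (F : IsFrame φ m top) : -top ∈ signVertices m σ := by
  rcases F.top_eq with rfl | rfl
  · exact Or.inl (Or.inr rfl)
  · exact Or.inl (Or.inl (neg_neg _))

theorem IsFrame.eq_top_or (F : IsFrame φ m top) {ε : SignType} (hε : ε ≠ 0) :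
    signVertex m ε = top ∨ signVertex m ε = -top := by
  rcases SignType.eq_one_or_neg_one hε with rfl | rfl <;> rcases F.top_eq with h | h <;> simp [h]

theorem IsFrame.signVertex_ne (F : IsFrame φ m top) (i : {i : Fin n // i ≠ m}) {ε : SignType}
    (hε : ε ≠ 0) : signVertex i.1 ε ≠ top ∧ signVertex i.1 ε ≠ -top := by
  have : ∀ δ : SignType, δ ≠ 0 → signVertex i.1 ε ≠ signVertex m δ := fun δ hδ h =>
    i.2 ((signVertex_inj hε hδ).1 h).1
  have h₁ := this 1 (by decide)
  have h₂ := this (-1) (by decide)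
  rw [signVertex_one] at h₁
  rw [signVertex_neg_one] at h₂
  rcases F.top_eq with rfl | rfl
  · exact ⟨h₁, h₂⟩
  · exact ⟨h₂, by rwa [neg_neg]⟩

/-- Every vertex of the cross-polytope is extremal for `φ` or of the form `ε eᵢ` with `i ≠ m`. -/
theorem IsFrame.cases_mem (F : IsFrame φ m top) {r : EuclideanSpace ℝ (Fin n)}
    (hr : r ∈ crossVertices n) :
    r = top ∨ r = -top ∨ ∃ (i : {i : Fin n // i ≠ m}) (ε : SignType), ε ≠ 0 ∧
      r = signVertex i.1 ε := by
  obtain ⟨i, ε, hε, rfl⟩ := mem_crossVertices_iff.1 hr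
  by_cases hi : i = m
  · subst hi
    rcases F.eq_top_or hε with h | h
    · exact Or.inl h
    · exact Or.inr (Or.inl h)
  · exact Or.inr (Or.inr ⟨⟨i, hi⟩, ε, hε, rfl⟩)

theorem IsFrame.exists_signPath (F : IsFrame φ m top) (σ : {i : Fin n // i ≠ m} → SignType) :
    ∃ l, IsIncreasing φ l ∧ ∀ p, p ∈ l ↔ p ∈ signVertices m σ :=
  exists_isIncreasing (finite_crossVertices.subset signVertices_subset)
    (F.inj.mono signVertices_subset)

/-- The increasing list of the vertices on the monotone path with sign vector `σ`. -/
noncomputable def IsFrame.signPath (F : IsFrame φ m top) (σ : {i : Fin n // i ≠ m} → SignType) :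
    List (EuclideanSpace ℝ (Fin n)) := (F.exists_signPath σ).choose

theorem IsFrame.mem_signPath (F : IsFrame φ m top) {p : EuclideanSpace ℝ (Fin n)} :
    p ∈ F.signPath σ ↔ p ∈ signVertices m σ := (F.exists_signPath σ).choose_spec.2 p

theorem IsFrame.isPath_signPath (F : IsFrame φ m top) (σ : {i : Fin n // i ≠ m} → SignType) :
    IsPath φ (crossVertices n) (-top) top (F.signPath σ) where
  increasing := (F.exists_signPath σ).choose_spec.1
  subset _ hp := signVertices_subset (F.mem_signPath.1 hp)
  bot_mem := F.mem_signPath.2 F.neg_top_mem_signVertices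
  top_mem := F.mem_signPath.2 F.top_mem_signVertices

theorem IsFrame.eq_signPath (F : IsFrame φ m top) {l : List (EuclideanSpace ℝ (Fin n))}
    (hl : IsIncreasing φ l) (h : ∀ p, p ∈ l ↔ p ∈ signVertices m σ) : l = F.signPath σ :=
  hl.eq_of_mem_iff (F.isPath_signPath σ).increasing fun p => by rw [h, F.mem_signPath]

theorem IsFrame.ne_top_of_infix (F : IsFrame φ m top) (hσ : σ ≠ 0)
    {p q : EuclideanSpace ℝ (Fin n)} (hpq : [p, q] <:+: F.signPath σ) :
    ¬ (p = -top ∧ q = top) := by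
  rintro ⟨rfl, rfl⟩
  obtain ⟨i, hi⟩ := Function.ne_iff.1 hσ
  rw [Pi.zero_apply] at hi
  have hw := signVertex_mem_crossVertices i.1 hi
  have hne := F.signVertex_ne i hi
  rcases (F.isPath_signPath σ).increasing.le_or_le_of_infix hpq
    (F.mem_signPath.2 ((signVertex_mem_signVertices i hi).2 rfl)) with h | h
  · exact hne.2 (F.inj hw F.neg_top_mem (le_antisymm h (F.neg_top_le _ hw)))
  · exact hne.1 (F.inj hw F.top_mem (le_antisymm (F.le_top _ hw) h))

/-- Functionals whose values on the path of `σ` are those of a concave parabola, and which are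
nonpositive on all other vertices. -/
structure IsSignFunctional (φ : EuclideanSpace ℝ (Fin n) →L[ℝ] ℝ) (m : Fin n)
    (top : EuclideanSpace ℝ (Fin n)) (σ : {i : Fin n // i ≠ m} → SignType)
    (c : EuclideanSpace ℝ (Fin n) →L[ℝ] ℝ) : Prop where
  eq_of_mem : ∀ r ∈ signVertices m σ, c r = φ top ^ 2 - φ r ^ 2
  nonpos : ∀ r ∈ crossVertices n, r ∉ signVertices m σ → c r ≤ 0

theorem IsFrame.sq_le (F : IsFrame φ m top) {r : EuclideanSpace ℝ (Fin n)}
    (hr : r ∈ crossVertices n) : φ r ^ 2 ≤ φ top ^ 2 := by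
  have h₁ := F.le_top r hr
  have h₂ := F.neg_top_le r hr
  rw [map_neg] at h₂
  nlinarith

theorem IsFrame.exists_isSignFunctional (F : IsFrame φ m top)
    (σ : {i : Fin n // i ≠ m} → SignType) : ∃ c, IsSignFunctional φ m top σ c := by
  obtain ⟨c, hc⟩ := exists_functional fun i : Fin n =>
    if hi : i ≠ m then (σ ⟨i, hi⟩ : ℝ) * (φ top ^ 2 - φ (stdVec i) ^ 2) else 0
  have hct : c top = 0 := by
    have : c (stdVec m) = 0 := by rw [hc, dif_neg (by simp)]
    rcases F.top_eq with rfl | rfl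
    · exact this
    · rw [map_neg, this, neg_zero]
  have hci : ∀ (i : {i : Fin n // i ≠ m}) (ε : SignType), c (signVertex i.1 ε) =
      (ε : ℝ) * ((σ i : ℝ) * (φ top ^ 2 - φ (stdVec i.1) ^ 2)) := fun i ε => by
    rw [signVertex, map_smul, hc, dif_pos i.2, smul_eq_mul]
  refine ⟨c, fun r hr => ?_, fun r hr hrσ => ?_⟩
  · rcases F.cases_mem (signVertices_subset hr) with rfl | rfl | ⟨i, ε, hε, rfl⟩
    · rw [hct, sub_self]
    · rw [map_neg, hct, map_neg]
      ring
    · rw [signVertex_mem_signVertices i hε] at hr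
      rw [hci, hr]
      rcases SignType.eq_one_or_neg_one hε with rfl | rfl <;> simp
  · rcases F.cases_mem hr with rfl | rfl | ⟨i, ε, hε, rfl⟩
    · exact absurd F.top_mem_signVertices hrσ
    · exact absurd F.neg_top_mem_signVertices hrσ
    · rw [signVertex_mem_signVertices i hε] at hrσ
      rw [hci, ← mul_assoc]
      refine mul_nonpos_of_nonpos_of_nonneg ?_
        (sub_nonneg.2 (F.sq_le (stdVec_mem_crossVertices i.1)))
      generalize σ i = δ at hrσ
      cases ε <;> cases δ <;> simp_all

variable {c : EuclideanSpace ℝ (Fin n) →L[ℝ] ℝ}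

theorem IsFrame.chord_pos (F : IsFrame φ m top) (hσ : σ ≠ 0) {p q r : EuclideanSpace ℝ (Fin n)}
    (hpq : [p, q] <:+: F.signPath σ) (hr : r ∈ crossVertices n) (hrt : r ≠ top) (hrb : r ≠ -top) :
    0 < φ top ^ 2 + φ p * φ q + -(φ p + φ q) * φ r := by
  have hl := F.isPath_signPath σ
  have hlt := hl.increasing.lt_of_infix hpq
  have hpW := hl.subset p (mem_of_pair_infix hpq).1
  have hqW := hl.subset q (mem_of_pair_infix hpq).2
  have hp₁ := F.neg_top_le p hpW
  have hq₂ := F.le_top q hqW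
  have hr₁ : φ (-top) < φ r :=
    lt_of_le_of_ne (F.neg_top_le r hr) fun e => hrb (F.inj hr F.neg_top_mem e.symm)
  have hr₂ : φ r < φ top := lt_of_le_of_ne (F.le_top r hr) fun e => hrt (F.inj hr F.top_mem e)
  rw [map_neg] at hp₁ hr₁
  have hM := F.pos
  set M := φ top
  have key : 2 * M * (M ^ 2 + φ p * φ q + -(φ p + φ q) * φ r) =
      (M - φ r) * ((M + φ p) * (M + φ q)) + (M + φ r) * ((M - φ p) * (M - φ q)) := by ring
  have h₁ : 0 ≤ (M + φ p) * (M + φ q) := by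
    apply mul_nonneg <;> linarith
  have h₂ : 0 ≤ (M - φ p) * (M - φ q) := by
    apply mul_nonneg <;> linarith
  have hpos : 0 < 2 * M * (M ^ 2 + φ p * φ q + -(φ p + φ q) * φ r) := by
    rw [key]
    by_cases hpb : p = -top
    · have hqt : q ≠ top := fun h => F.ne_top_of_infix hσ hpq ⟨hpb, h⟩
      have hq : φ q < M := lt_of_le_of_ne hq₂ fun e => hqt (F.inj hqW F.top_mem e)
      have : 0 < (M + φ r) * ((M - φ p) * (M - φ q)) :=
        mul_pos (by linarith) (mul_pos (by linarith) (by linarith))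
      linarith [mul_nonneg (by linarith : 0 ≤ M - φ r) h₁]
    · have hp : -M < φ p := lt_of_le_of_ne hp₁ fun e =>
        hpb (F.inj hpW F.neg_top_mem (by rw [← e, map_neg]))
      have : 0 < (M - φ r) * ((M + φ p) * (M + φ q)) :=
        mul_pos (by linarith) (mul_pos (by linarith) (by linarith))
      linarith [mul_nonneg (by linarith : 0 ≤ M + φ r) h₂]
  exact pos_of_mul_pos_right hpos (by linarith)

theorem IsSignFunctional.le_chord (hc : IsSignFunctional φ m top σ c) (F : IsFrame φ m top)
    (hσ : σ ≠ 0) {p q r : EuclideanSpace ℝ (Fin n)} (hpq : [p, q] <:+: F.signPath σ)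
    (hr : r ∈ crossVertices n) :
    c r ≤ φ top ^ 2 + φ p * φ q + -(φ p + φ q) * φ r ∧
      (c r = φ top ^ 2 + φ p * φ q + -(φ p + φ q) * φ r → r ∈ signVertices m σ) := by
  by_cases hrσ : r ∈ signVertices m σ
  · refine ⟨?_, fun _ => hrσ⟩
    rw [hc.eq_of_mem r hrσ]
    have hlt := (F.isPath_signPath σ).increasing.lt_of_infix hpq
    rcases (F.isPath_signPath σ).increasing.le_or_le_of_infix hpq (F.mem_signPath.2 hrσ) with h | h
    <;> nlinarith
  · have hpos := F.chord_pos hσ hpq hr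
      (fun h => hrσ (h ▸ F.top_mem_signVertices)) (fun h => hrσ (h ▸ F.neg_top_mem_signVertices))
    have := hc.nonpos r hr hrσ
    exact ⟨by linarith, fun h => absurd h (by linarith)⟩

theorem IsSignFunctional.eq_chord (hc : IsSignFunctional φ m top σ c) (F : IsFrame φ m top)
    {p q : EuclideanSpace ℝ (Fin n)} (hpq : [p, q] <:+: F.signPath σ) :
    c p = φ top ^ 2 + φ p * φ q + -(φ p + φ q) * φ p ∧
      c q = φ top ^ 2 + φ p * φ q + -(φ p + φ q) * φ q := by
  have hm := mem_of_pair_infix hpq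
  rw [hc.eq_of_mem p (F.mem_signPath.1 hm.1), hc.eq_of_mem q (F.mem_signPath.1 hm.2)]
  constructor <;> ring

theorem IsSignFunctional.isOptimal (hc : IsSignFunctional φ m top σ c) (F : IsFrame φ m top)
    (hσ : σ ≠ 0) : IsOptimal φ (crossVertices n) c (F.signPath σ) :=
  isOptimal_of_supporting (F.isPath_signPath σ) F.lt F.neg_top_le F.le_top fun _ _ hpq =>
    ⟨_, _, fun _ hr => (hc.le_chord F hσ hpq hr).1, hc.eq_chord F hpq⟩

theorem IsSignFunctional.le_parabola (hc : IsSignFunctional φ m top σ c) (F : IsFrame φ m top)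
    {r : EuclideanSpace ℝ (Fin n)} (hr : r ∈ crossVertices n) : c r ≤ φ top ^ 2 - φ r ^ 2 := by
  by_cases hrσ : r ∈ signVertices m σ
  · exact (hc.eq_of_mem r hrσ).le
  · linarith [hc.nonpos r hr hrσ, F.sq_le hr]

/-- The height of the path of `σ` over a vertex. -/
theorem IsSignFunctional.height (hc : IsSignFunctional φ m top σ c) (F : IsFrame φ m top)
    (hσ : σ ≠ 0) {w : EuclideanSpace ℝ (Fin n)} (hw : w ∈ crossVertices n)
    (hwσ : w ∉ signVertices m σ) :
    0 < c (pathSection φ (F.signPath σ) (φ w)) ∧ c w < c (pathSection φ (F.signPath σ) (φ w)) ∧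
      c (pathSection φ (F.signPath σ) (φ w)) ≤ φ top ^ 2 - φ w ^ 2 := by
  have hl := F.isPath_signPath σ
  obtain ⟨p, q, hpq, hp, hq⟩ := hl.exists_infix F.lt (F.neg_top_le w hw) (F.le_top w hw)
  have he := hc.eq_chord F hpq
  have hlt := hl.increasing.lt_of_infix hpq
  have hpos := F.chord_pos hσ hpq hw
    (fun h => hwσ (h ▸ F.top_mem_signVertices)) (fun h => hwσ (h ▸ F.neg_top_mem_signVertices))
  rw [pathSection_eq_interp hl.increasing hpq hp hq, apply_interp_eq_affine hlt he.1 he.2]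
  exact ⟨hpos, by linarith [hc.nonpos w hw hwσ], by nlinarith⟩

/-- If `c` lies below a concave parabola, then optimal paths for `c` pass through all vertices
on the parabola. -/
theorem IsFrame.mem_of_isOptimal (F : IsFrame φ m top)
    (hc : ∀ r ∈ crossVertices n, c r ≤ φ top ^ 2 - φ r ^ 2)
    {l : List (EuclideanSpace ℝ (Fin n))} (hl : IsPath φ (crossVertices n) (-top) top l)
    (h : IsOptimal φ (crossVertices n) c l) {p : EuclideanSpace ℝ (Fin n)}
    (hp : p ∈ crossVertices n) (hcp : c p = φ top ^ 2 - φ p ^ 2) : p ∈ l := by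
  obtain ⟨a, b, hab, ha, hb⟩ := hl.exists_infix F.lt (F.neg_top_le p hp) (F.le_top p hp)
  have hm := mem_of_pair_infix hab
  have haW := hl.subset a hm.1
  have hbW := hl.subset b hm.2
  by_cases hpa : p = a
  · exact hpa ▸ hm.1
  by_cases hpb : p = b
  · exact hpb ▸ hm.2
  have ha' : φ a < φ p := lt_of_le_of_ne ha fun e => hpa (F.inj hp haW e.symm)
  have hb' : φ p < φ b := lt_of_le_of_ne hb fun e => hpb (F.inj hp hbW e)
  have h1 := h p (subset_convexHull ℝ _ hp)
  rw [pathSection_eq_interp hl.increasing hab ha hb, apply_interp, hcp] at h1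
  have hca := hc a haW
  have hcb := hc b hbW
  have hd : 0 < φ b - φ a := by linarith
  have h2 : (φ p - φ a) / (φ b - φ a) * (c b - c a) * (φ b - φ a)
      = (φ p - φ a) * (c b - c a) := by field_simp
  have h3 : (φ top ^ 2 - φ p ^ 2) * (φ b - φ a) ≤
      (φ b - φ p) * c a + (φ p - φ a) * c b := by nlinarith
  have h4 : (φ b - φ p) * c a ≤ (φ b - φ p) * (φ top ^ 2 - φ a ^ 2) :=
    mul_le_mul_of_nonneg_left hca (by linarith)
  have h5 : (φ p - φ a) * c b ≤ (φ p - φ a) * (φ top ^ 2 - φ b ^ 2) :=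
    mul_le_mul_of_nonneg_left hcb (by linarith)
  have h6 : 0 < (φ p - φ a) * (φ b - φ p) * (φ b - φ a) :=
    mul_pos (mul_pos (by linarith) (by linarith)) hd
  nlinarith

/-- The path of a nonzero sign vector is the only optimal one for some functional. -/
theorem IsFrame.exists_isOptimal_iff_eq (F : IsFrame φ m top) (hσ : σ ≠ 0) :
    ∃ c : EuclideanSpace ℝ (Fin n) →L[ℝ] ℝ, ∀ ρ : {i : Fin n // i ≠ m} → SignType,
      IsOptimal φ (crossVertices n) c (F.signPath ρ) ↔ ρ = σ := by
  obtain ⟨c, hc⟩ := F.exists_isSignFunctional σ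
  refine ⟨c, fun ρ => ⟨fun h => ?_, fun h => h ▸ hc.isOptimal F hσ⟩⟩
  have hρ := F.isPath_signPath ρ
  have hσ' := F.isPath_signPath σ
  refine signVertices_injective (Set.Subset.antisymm (fun r hr => ?_) fun p hp => ?_)
  · have hrW := signVertices_subset hr
    by_contra hrσ
    have h1 := (hc.height F hσ hrW hrσ).2.1
    have h2 := h _ (hσ'.pathSection_mem F.lt (F.neg_top_le r hrW) (F.le_top r hrW)).1
    rw [(hσ'.pathSection_mem F.lt (F.neg_top_le r hrW) (F.le_top r hrW)).2,
      pathSection_of_mem hρ.increasing (F.mem_signPath.2 hr)] at h2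
    linarith
  · exact F.mem_signPath.1 (F.mem_of_isOptimal (fun r hr => hc.le_parabola F hr) hρ h
      (signVertices_subset hp) (hc.eq_of_mem p hp))

/-- Two paths that differ by one vertex are the only optimal ones for some functional. -/
theorem IsFrame.exists_isOptimal_iff_eq_or_eq (F : IsFrame φ m top) (hτ : τ ≠ 0)
    (i : {i : Fin n // i ≠ m}) (hi : τ i = 0) {ε : SignType} (hε : ε ≠ 0) :
    ∃ c : EuclideanSpace ℝ (Fin n) →L[ℝ] ℝ, ∀ ρ : {i : Fin n // i ≠ m} → SignType,
      IsOptimal φ (crossVertices n) c (F.signPath ρ) ↔ ρ = τ ∨ ρ = Function.update τ i ε := by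
  obtain ⟨c₀, hc₀⟩ := F.exists_isSignFunctional τ
  have hV := signVertices_update i hi hε
  have hlσ := F.isPath_signPath (Function.update τ i ε)
  have hlτ := F.isPath_signPath τ
  set σ := Function.update τ i ε
  set w := signVertex i.1 ε with hwdef
  have hw : w ∈ crossVertices n := signVertex_mem_crossVertices _ hε
  have hwτ : w ∉ signVertices m τ := by
    rw [signVertex_mem_signVertices i hε, hi]
    exact hε.symm
  have hε' : -ε ≠ 0 := by rcases SignType.eq_one_or_neg_one hε with h | h <;> rw [h] <;> decide
  have hnwτ : -w ∉ signVertices m τ := by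
    rw [hwdef, neg_signVertex, signVertex_mem_signVertices i hε', hi]
    exact hε'.symm
  have hc₀w : c₀ w = 0 := by
    have h1 := hc₀.nonpos w hw hwτ
    have h2 := hc₀.nonpos _ (neg_mem_crossVertices hw) hnwτ
    rw [map_neg] at h2
    linarith
  obtain ⟨hpos, -, hpar⟩ := hc₀.height F hτ hw hwτ
  set H := c₀ (pathSection φ (F.signPath τ) (φ w)) with hH
  let c : EuclideanSpace ℝ (Fin n) →L[ℝ] ℝ := c₀ + H • innerSL ℝ w
  have hcapp : ∀ r, c r = c₀ r + H * inner ℝ w r := fun r => by simp [c]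
  have hcw : c w = H := by rw [hcapp, hc₀w, inner_self_of_mem hw]; ring
  have hc : ∀ r ∈ crossVertices n, r ≠ w → r ≠ -w → c r = c₀ r := fun r hr h₁ h₂ => by
    rw [hcapp, inner_eq_zero_of_mem hw hr h₁.symm (fun h => h₂ (by rw [h, neg_neg])), mul_zero,
      add_zero]
  have hcτ : ∀ r ∈ signVertices m τ, c r = c₀ r := fun r hr =>
    hc r (signVertices_subset hr) (fun h => hwτ (h ▸ hr)) (fun h => hnwτ (h ▸ hr))
  have hparabola : ∀ r ∈ crossVertices n, c r ≤ φ top ^ 2 - φ r ^ 2 := fun r hr => by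
    by_cases h1 : r = w
    · rw [h1, hcw]
      exact hpar
    by_cases h2 : r = -w
    · rw [h2, map_neg, hcw]
      linarith [F.sq_le (neg_mem_crossVertices hw)]
    rw [hc r hr h1 h2]
    exact hc₀.le_parabola F hr
  have hsec : ∀ r ∈ crossVertices n, c (pathSection φ (F.signPath τ) (φ r)) =
      c₀ (pathSection φ (F.signPath τ) (φ r)) := fun r hr => by
    obtain ⟨p, q, hpq, hp, hq⟩ := hlτ.exists_infix F.lt (F.neg_top_le r hr) (F.le_top r hr)
    have hm := mem_of_pair_infix hpq
    rw [pathSection_eq_interp hlτ.increasing hpq hp hq, apply_interp, apply_interp,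
      hcτ p (F.mem_signPath.1 hm.1), hcτ q (F.mem_signPath.1 hm.2)]
  have hoptτ : IsOptimal φ (crossVertices n) c (F.signPath τ) := by
    refine isOptimal_of_supporting hlτ F.lt F.neg_top_le F.le_top fun p q hpq => ?_
    have hm := mem_of_pair_infix hpq
    have he := hc₀.eq_chord F hpq
    refine ⟨_, _, fun r hr => ?_, (hcτ p (F.mem_signPath.1 hm.1)).trans he.1,
      (hcτ q (F.mem_signPath.1 hm.2)).trans he.2⟩
    by_cases h1 : r = w
    · have hmem := hlτ.pathSection_mem F.lt (F.neg_top_le w hw) (F.le_top w hw)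
      have := apply_le_of_mem_convexHull (c₀ - (-(φ p + φ q)) • φ)
        (μ := φ top ^ 2 + φ p * φ q)
        (fun s hs => by
          have := (hc₀.le_chord F hτ hpq hs).1
          simp only [sub_apply, smul_apply, smul_eq_mul]
          linarith) hmem.1
      simp only [sub_apply, smul_apply, smul_eq_mul, hmem.2] at this
      rw [h1, hcw]
      linarith
    by_cases h2 : r = -w
    · have := F.chord_pos hτ hpq hr
        (fun h => hnwτ (h2 ▸ h ▸ F.top_mem_signVertices))
        (fun h => hnwτ (h2 ▸ h ▸ F.neg_top_mem_signVertices))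
      rw [h2] at this ⊢
      rw [map_neg c, hcw]
      linarith
    rw [hc r hr h1 h2]
    exact (hc₀.le_chord F hτ hpq hr).1
  have hsub : ∀ p ∈ F.signPath τ, p ∈ F.signPath σ := fun p hp => by
    rw [F.mem_signPath] at hp ⊢
    rw [hV]
    exact Or.inr hp
  have hoptσ : IsOptimal φ (crossVertices n) c (F.signPath σ) := by
    refine hoptτ.refine hlτ hlσ F.lt F.neg_top_le F.le_top hsub fun p hp => ?_
    rw [F.mem_signPath, hV] at hp
    rcases hp with rfl | hp
    · intro y hy hyw
      have := hoptτ y hy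
      rwa [hyw, hsec w hw, ← hH, ← hcw] at this
    · exact hoptτ.isUpper hlτ.increasing (F.mem_signPath.2 hp)
  refine ⟨c, fun ρ => ⟨fun h => ?_, by rintro (rfl | rfl) <;> assumption⟩⟩
  have hρ := F.isPath_signPath ρ
  have hsub₁ : signVertices m τ ⊆ signVertices m ρ := fun p hp =>
    F.mem_signPath.1 (F.mem_of_isOptimal hparabola hρ h (signVertices_subset hp)
      ((hcτ p hp).trans (hc₀.eq_of_mem p hp)))
  have hsub₂ : signVertices m ρ ⊆ insert w (signVertices m τ) := fun r hr => by
    have hrW := signVertices_subset hr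
    by_contra hcon
    rw [Set.mem_insert_iff, not_or] at hcon
    have hmem := hlτ.pathSection_mem F.lt (F.neg_top_le r hrW) (F.le_top r hrW)
    have h2 := h _ hmem.1
    rw [hmem.2, pathSection_of_mem hρ.increasing (F.mem_signPath.2 hr), hsec r hrW] at h2
    have h3 := hc₀.height F hτ hrW hcon.2
    by_cases h4 : r = -w
    · rw [h4, map_neg c, hcw, ← h4] at h2
      linarith
    · rw [hc r hrW hcon.1 h4] at h2
      linarith
  by_cases hwρ : w ∈ signVertices m ρ
  · right
    apply signVertices_injective
    rw [hV]
    exact Set.Subset.antisymm hsub₂ (Set.insert_subset hwρ hsub₁)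
  · left
    apply signVertices_injective
    refine Set.Subset.antisymm (fun r hr => ?_) hsub₁
    exact (hsub₂ hr).resolve_left fun h => hwρ (h ▸ hr)

end SignVectors

section MonotonePathPolytope

variable {n : ℕ} {m : Fin n} {φ : EuclideanSpace ℝ (Fin n) →L[ℝ] ℝ}
  {top : EuclideanSpace ℝ (Fin n)} {σ τ : {i : Fin n // i ≠ m} → SignType}
  {c : EuclideanSpace ℝ (Fin n) →L[ℝ] ℝ} {l l' : List (EuclideanSpace ℝ (Fin n))}

/-- The average value of the section along a list of vertices of the cross-polytope. -/
noncomputable def pathAverage (φ : EuclideanSpace ℝ (Fin n) →L[ℝ] ℝ)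
    (l : List (EuclideanSpace ℝ (Fin n))) : EuclideanSpace ℝ (Fin n) :=
  ⨍ x in φ '' crossPolytope n, pathSection φ l x

theorem IsPath.isSection (hl : IsPath φ (crossVertices n) (-top) top l) (F : IsFrame φ m top) :
    IsSection (crossPolytope n) φ (pathSection φ l) := by
  refine ⟨(continuous_pathSection hl.increasing).continuousOn, fun x hx => ?_⟩
  rw [F.image_eq] at hx
  exact hl.pathSection_mem F.lt hx.1 hx.2

theorem IsOptimal.apply_le (h : IsOptimal φ (crossVertices n) c l)
    {s : ℝ → EuclideanSpace ℝ (Fin n)} (hs : IsSection (crossPolytope n) φ s)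
    {x : ℝ} (hx : x ∈ φ '' crossPolytope n) : c (s x) ≤ c (pathSection φ l x) := by
  have := h _ (hs.2 x hx).1
  rwa [(hs.2 x hx).2] at this

theorem IsOptimal.apply_average_le (h : IsOptimal φ (crossVertices n) c l) (F : IsFrame φ m top)
    (hl : IsPath φ (crossVertices n) (-top) top l)
    {s : ℝ → EuclideanSpace ℝ (Fin n)} (hs : IsSection (crossPolytope n) φ s) :
    c (⨍ x in φ '' crossPolytope n, s x) ≤ c (pathAverage φ l) := by
  have hc := fun x => h.apply_le hs (x := x)
  have hcs := hs.1
  have hcl := (hl.isSection F).1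
  unfold pathAverage
  rw [F.image_eq] at hc hcs hcl ⊢
  rw [apply_setAverage_Icc c hcs, apply_setAverage_Icc c hcl]
  exact setAverage_Icc_le (c.continuous.comp_continuousOn hcs) (c.continuous.comp_continuousOn hcl)
    hc

theorem IsOptimal.of_apply_eq (h : IsOptimal φ (crossVertices n) c l) (F : IsFrame φ m top)
    (hl : IsPath φ (crossVertices n) (-top) top l)
    (hl' : IsPath φ (crossVertices n) (-top) top l')
    (he : c (pathAverage φ l') = c (pathAverage φ l)) : IsOptimal φ (crossVertices n) c l' := by
  intro y hy
  have hc := fun x => h.apply_le (hl'.isSection F) (x := x)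
  have hcs := (hl'.isSection F).1
  have hcl := (hl.isSection F).1
  have hx : φ y ∈ φ '' crossPolytope n := ⟨y, hy, rfl⟩
  unfold pathAverage at he
  rw [F.image_eq] at hc hcs hcl hx he
  rw [apply_setAverage_Icc c hcs, apply_setAverage_Icc c hcl] at he
  exact (h y hy).trans (eq_of_setAverage_Icc_eq F.lt (c.continuous.comp_continuousOn hcs)
    (c.continuous.comp_continuousOn hcl) hc he hx).ge

theorem exists_ne_zero_signVector (hn : 2 ≤ n) (m : Fin n) :
    ∃ σ : {i : Fin n // i ≠ m} → SignType, σ ≠ 0 := by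
  have : Nontrivial (Fin n) := Fin.nontrivial_iff_two_le.2 hn
  obtain ⟨j, hj⟩ := exists_ne m
  exact ⟨fun _ => 1, Function.ne_iff.2 ⟨⟨j, hj⟩, one_ne_zero⟩⟩

/-- Every functional is maximized on all fibers by the path of some nonzero sign vector. -/
theorem IsFrame.exists_isOptimal (F : IsFrame φ m top) (hn : 2 ≤ n)
    (c : EuclideanSpace ℝ (Fin n) →L[ℝ] ℝ) :
    ∃ ρ : {i : Fin n // i ≠ m} → SignType, ρ ≠ 0 ∧
      IsOptimal φ (crossVertices n) c (F.signPath ρ) := by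
  classical
  by_cases hdeg : ∃ β : ℝ, ∀ r ∈ crossVertices n, c r = β * φ r
  · obtain ⟨β, hβ⟩ := hdeg
    obtain ⟨ρ, hρ⟩ := exists_ne_zero_signVector hn m
    exact ⟨ρ, hρ, F.isOptimal_of_eq_mul hβ (F.isPath_signPath ρ)⟩
  let ρ : {i : Fin n // i ≠ m} → SignType := fun i =>
    if IsUpper φ (crossVertices n) c (signVertex i.1 1) then 1
    else if IsUpper φ (crossVertices n) c (signVertex i.1 (-1)) then -1 else 0
  have hρ : ∀ r, r ∈ signVertices m ρ ↔ r ∈ crossVertices n ∧ IsUpper φ (crossVertices n) c r := by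
    intro r
    rw [← and_iff_right_of_imp (signVertices_subset (σ := ρ) (a := r))]
    refine and_congr_right fun hr => ?_
    rcases F.cases_mem hr with rfl | rfl | ⟨i, ε, hε, rfl⟩
    · exact iff_of_true F.top_mem_signVertices (F.isUpper_top c)
    · exact iff_of_true F.neg_top_mem_signVertices (F.isUpper_neg_top c)
    · rw [signVertex_mem_signVertices i hε]
      have hnot : IsUpper φ (crossVertices n) c (signVertex i.1 1) →
          ¬ IsUpper φ (crossVertices n) c (signVertex i.1 (-1)) := fun h₁ h₂ => by
        have hne := F.signVertex_ne i (ε := 1) (by decide)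
        rw [← neg_signVertex] at h₂
        exact hdeg ⟨_, F.eq_mul_of_isUpper (signVertex_mem_crossVertices _ (by decide))
          hne.1 hne.2 h₁ h₂⟩
      rcases SignType.eq_one_or_neg_one hε with rfl | rfl
      · by_cases h₁ : IsUpper φ (crossVertices n) c (signVertex i.1 1)
        · exact iff_of_true (if_pos h₁) h₁
        · refine iff_of_false ?_ h₁
          simp only [ρ, if_neg h₁]
          split_ifs <;> decide
      · by_cases h₁ : IsUpper φ (crossVertices n) c (signVertex i.1 1)
        · refine iff_of_false ?_ (hnot h₁)
          simp only [ρ, if_pos h₁]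
          decide
        · simp only [ρ, if_neg h₁]
          by_cases h₂ : IsUpper φ (crossVertices n) c (signVertex i.1 (-1))
          · exact iff_of_true (if_pos h₂) h₂
          · refine iff_of_false ?_ h₂
            rw [if_neg h₂]
            decide
  have hl := F.isPath_signPath ρ
  have hopt : IsOptimal φ (crossVertices n) c (F.signPath ρ) := by
    refine isOptimal_of_supporting hl F.lt F.neg_top_le F.le_top fun p q hpq => ?_
    have hm := mem_of_pair_infix hpq
    have hp := (hρ p).1 (F.mem_signPath.1 hm.1)
    have hq := (hρ q).1 (F.mem_signPath.1 hm.2)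
    exact exists_supporting finite_crossVertices hp.1 hq.1 hp.2 hq.2
      (hl.increasing.lt_of_infix hpq) fun r hr hrU =>
        hl.increasing.le_or_le_of_infix hpq (F.mem_signPath.2 ((hρ r).2 ⟨hr, hrU⟩))
  refine ⟨ρ, fun h0 => hdeg ⟨c top / φ top, eq_mul_of_le_mul fun r hr => ?_⟩, hopt⟩
  have h1 := hopt r (subset_convexHull ℝ _ hr)
  obtain ⟨p, q, hpq, hp, hq⟩ := hl.exists_infix F.lt (F.neg_top_le r hr) (F.le_top r hr)
  have hmem : ∀ s ∈ F.signPath ρ, s = top ∨ s = -top := fun s hs => by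
    rcases F.mem_signPath.1 hs with h | ⟨i, hi, -⟩
    · rcases h with rfl | rfl <;> rcases F.top_eq with h | h <;> simp [h]
    · exact absurd (congrFun h0 i) hi
  have hlt := hl.increasing.lt_of_infix hpq
  have hm := mem_of_pair_infix hpq
  rw [pathSection_eq_interp hl.increasing hpq hp hq] at h1
  have hlt' := F.lt
  rcases hmem p hm.1 with rfl | rfl <;> rcases hmem q hm.2 with rfl | rfl
  · exact absurd hlt (lt_irrefl _)
  · exact absurd hlt hlt'.not_gt
  · rwa [F.apply_interp_top] at h1
  · exact absurd hlt (lt_irrefl _)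

/-- The candidates for the vertices of the monotone path polytope. -/
noncomputable def IsFrame.signAverage (F : IsFrame φ m top)
    (σ : {i : Fin n // i ≠ m} → SignType) : EuclideanSpace ℝ (Fin n) :=
  pathAverage φ (F.signPath σ)

theorem IsFrame.apply_signAverage_eq_iff (F : IsFrame φ m top)
    (h : IsOptimal φ (crossVertices n) c (F.signPath σ)) :
    c (F.signAverage τ) = c (F.signAverage σ) ↔
      IsOptimal φ (crossVertices n) c (F.signPath τ) := by
  have hσ := F.isPath_signPath σ
  have hτ := F.isPath_signPath τ
  exact ⟨fun he => h.of_apply_eq F hσ hτ he, fun h' =>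
    le_antisymm (h.apply_average_le F hσ (hτ.isSection F))
      (h'.apply_average_le F hτ (hσ.isSection F))⟩

theorem IsFrame.monotonePathPolytope_eq (F : IsFrame φ m top) (hn : 2 ≤ n) :
    monotonePathPolytope (crossPolytope n) φ = convexHull ℝ (F.signAverage '' {σ | σ ≠ 0}) := by
  refine Set.Subset.antisymm (convexHull_min ?_ (convex_convexHull ℝ _)) (convexHull_mono ?_)
  · rintro _ ⟨s, hs, rfl⟩
    by_contra hcon
    obtain ⟨c, u, h₁, h₂⟩ := geometric_hahn_banach_closed_point (convex_convexHull ℝ _)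
      (((Set.toFinite _).image _).isClosed_convexHull ℝ) hcon
    obtain ⟨ρ, hρ, hopt⟩ := F.exists_isOptimal hn c
    have h₃ := hopt.apply_average_le F (F.isPath_signPath ρ) hs
    have h₄ := h₁ _ (subset_convexHull ℝ _ ⟨ρ, hρ, rfl⟩)
    exact absurd (h₂.trans_le h₃) h₄.not_gt
  · rintro _ ⟨σ, -, rfl⟩
    exact ⟨_, (F.isPath_signPath σ).isSection F, rfl⟩

theorem IsFrame.setOf_isMax_eq (F : IsFrame φ m top) (hn : 2 ≤ n) (hσ : σ ≠ 0)
    (h : IsOptimal φ (crossVertices n) c (F.signPath σ)) :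
    {x | x ∈ monotonePathPolytope (crossPolytope n) φ ∧
        ∀ y ∈ monotonePathPolytope (crossPolytope n) φ, c y ≤ c x} =
      convexHull ℝ (F.signAverage ''
        {ρ | ρ ≠ 0 ∧ IsOptimal φ (crossVertices n) c (F.signPath ρ)}) := by
  rw [F.monotonePathPolytope_eq hn, setOf_isMax_convexHull c (Set.mem_image_of_mem F.signAverage hσ)]
  · congr 1
    ext x
    constructor
    · rintro ⟨⟨ρ, hρ, rfl⟩, he⟩
      exact ⟨ρ, ⟨hρ, (F.apply_signAverage_eq_iff h).1 he⟩, rfl⟩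
    · rintro ⟨ρ, ⟨hρ, hopt⟩, rfl⟩
      exact ⟨⟨ρ, hρ, rfl⟩, (F.apply_signAverage_eq_iff h).2 hopt⟩
  · rintro _ ⟨ρ, -, rfl⟩
    exact h.apply_average_le F (F.isPath_signPath σ) ((F.isPath_signPath ρ).isSection F)

theorem IsFrame.signAverage_injOn (F : IsFrame φ m top) :
    Set.InjOn F.signAverage {σ | σ ≠ 0} := by
  intro σ hσ τ hτ h
  obtain ⟨c, hc⟩ := F.exists_isOptimal_iff_eq hσ
  exact ((hc τ).1 ((F.apply_signAverage_eq_iff ((hc σ).2 rfl)).1 (congrArg c h).symm)).symm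

theorem IsFrame.extremePoints_eq (F : IsFrame φ m top) (hn : 2 ≤ n) :
    Set.extremePoints ℝ (monotonePathPolytope (crossPolytope n) φ) =
      F.signAverage '' {σ | σ ≠ 0} := by
  refine Set.Subset.antisymm ?_ ?_
  · rw [F.monotonePathPolytope_eq hn]
    exact extremePoints_convexHull_subset
  · rintro _ ⟨σ, hσ, rfl⟩
    obtain ⟨c, hc⟩ := F.exists_isOptimal_iff_eq hσ
    rw [← isExtreme_singleton]
    refine IsExposed.isExtreme fun _ => ⟨c, ?_⟩
    rw [F.setOf_isMax_eq hn hσ ((hc σ).2 rfl)]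
    have : {ρ | ρ ≠ 0 ∧ IsOptimal φ (crossVertices n) c (F.signPath ρ)} = {σ} := by
      ext ρ
      simp only [Set.mem_ofPred_eq, Set.mem_singleton_iff, hc]
      exact ⟨fun h => h.2, fun h => ⟨h ▸ hσ, h⟩⟩
    rw [this, Set.image_singleton, convexHull_singleton]

/-- Paths whose sign vectors differ by one vertex give an edge. -/
theorem IsFrame.polytopeAdj_update (F : IsFrame φ m top) (hn : 2 ≤ n) (hτ : τ ≠ 0)
    (i : {i : Fin n // i ≠ m}) (hi : τ i = 0) {ε : SignType} (hε : ε ≠ 0) :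
    PolytopeAdj (monotonePathPolytope (crossPolytope n) φ) (F.signAverage τ)
      (F.signAverage (Function.update τ i ε)) := by
  have hσi : Function.update τ i ε i ≠ 0 := by rwa [Function.update_self]
  have hσ : Function.update τ i ε ≠ 0 := fun h => hσi (congrFun h i)
  refine ⟨fun h => hσi ?_, fun _ => ?_⟩
  · rw [← F.signAverage_injOn hτ hσ h, hi]
  · obtain ⟨c, hc⟩ := F.exists_isOptimal_iff_eq_or_eq hτ i hi hε
    refine ⟨c, ?_⟩
    rw [F.setOf_isMax_eq hn hτ ((hc τ).2 (Or.inl rfl))]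
    have : {ρ | ρ ≠ 0 ∧ IsOptimal φ (crossVertices n) c (F.signPath ρ)} =
        {τ, Function.update τ i ε} := by
      ext ρ
      simp only [Set.mem_ofPred_eq, Set.mem_insert_iff, Set.mem_singleton_iff, hc]
      refine ⟨fun h => h.2, fun h => ⟨?_, h⟩⟩
      rcases h with rfl | rfl <;> assumption
    rw [this, Set.image_pair, convexHull_pair]

theorem PolytopeAdj.symm {E : Type*} [NormedAddCommGroup E] [NormedSpace ℝ E] {P : Set E}
    {p q : E} (h : PolytopeAdj P p q) : PolytopeAdj P q p :=
  ⟨h.1.symm, segment_symm ℝ p q ▸ h.2⟩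

/-- An edge of the monotone path polytope is the face of a functional for which exactly the
paths of its endpoints are optimal. -/
theorem IsFrame.exists_isOptimal_iff_of_polytopeAdj (F : IsFrame φ m top) (hn : 2 ≤ n)
    (hσ : σ ≠ 0) (hτ : τ ≠ 0)
    (h : PolytopeAdj (monotonePathPolytope (crossPolytope n) φ) (F.signAverage σ)
      (F.signAverage τ)) :
    ∃ c : EuclideanSpace ℝ (Fin n) →L[ℝ] ℝ, ∀ ρ : {i : Fin n // i ≠ m} → SignType, ρ ≠ 0 →
      (IsOptimal φ (crossVertices n) c (F.signPath ρ) ↔ ρ = σ ∨ ρ = τ) := by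
  obtain ⟨c, hc⟩ := h.2 ⟨_, left_mem_segment ℝ _ _⟩
  obtain ⟨π, hπ, hopt⟩ := F.exists_isOptimal hn c
  have hmem : ∀ {ρ : {i : Fin n // i ≠ m} → SignType}, ρ ≠ 0 →
      F.signAverage ρ ∈ Set.extremePoints ℝ (monotonePathPolytope (crossPolytope n) φ) :=
    fun hρ => F.extremePoints_eq hn ▸ ⟨_, hρ, rfl⟩
  have hface : ∀ ρ : {i : Fin n // i ≠ m} → SignType, ρ ≠ 0 →
      (F.signAverage ρ ∈ segment ℝ (F.signAverage σ) (F.signAverage τ) ↔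
        IsOptimal φ (crossVertices n) c (F.signPath ρ)) := by
    intro ρ hρ
    rw [hc, ← F.apply_signAverage_eq_iff hopt]
    constructor
    · rintro ⟨-, hmax⟩
      exact le_antisymm (hopt.apply_average_le F (F.isPath_signPath π)
        ((F.isPath_signPath ρ).isSection F)) (hmax _ (hmem hπ).1)
    · intro he
      have hface := F.setOf_isMax_eq hn hπ hopt
      have : F.signAverage ρ ∈ convexHull ℝ (F.signAverage ''
          {ρ | ρ ≠ 0 ∧ IsOptimal φ (crossVertices n) c (F.signPath ρ)}) :=
        subset_convexHull ℝ _ ⟨ρ, ⟨hρ, (F.apply_signAverage_eq_iff hopt).1 he⟩, rfl⟩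
      rwa [← hface] at this
  refine ⟨c, fun ρ hρ => ?_⟩
  rw [← hface ρ hρ]
  constructor
  · intro hseg
    rcases (mem_extremePoints_iff_forall_segment.1 (hmem hρ)).2 _ (hmem hσ).1 _ (hmem hτ).1 hseg
      with h | h
    · exact Or.inl (F.signAverage_injOn hρ hσ h.symm)
    · exact Or.inr (F.signAverage_injOn hρ hτ h.symm)
  · rintro (rfl | rfl)
    · exact left_mem_segment ℝ _ _
    · exact right_mem_segment ℝ _ _

/-- If the path of `τ` can be extended by a vertex of the path of `σ`, and these are the only
optimal paths, then this extension is the path of `σ`. -/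
theorem IsFrame.eq_update_of_isOptimal_iff (F : IsFrame φ m top) (hσ : σ ≠ 0) (hτ : τ ≠ 0)
    (h : ∀ ρ : {i : Fin n // i ≠ m} → SignType, ρ ≠ 0 →
      (IsOptimal φ (crossVertices n) c (F.signPath ρ) ↔ ρ = σ ∨ ρ = τ))
    {i : {i : Fin n // i ≠ m}} (hσi : σ i ≠ 0) (hτi : τ i = 0) :
    σ = Function.update τ i (σ i) := by
  have hopt := (h σ hσ).2 (Or.inl rfl)
  have hoptτ := (h τ hτ).2 (Or.inr rfl)
  have hne : Function.update τ i (σ i) i ≠ 0 := by rwa [Function.update_self]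
  have hV := signVertices_update i hτi hσi
  have : IsOptimal φ (crossVertices n) c (F.signPath (Function.update τ i (σ i))) := by
    refine hoptτ.refine (F.isPath_signPath τ) (F.isPath_signPath _) F.lt F.neg_top_le F.le_top
      (fun p hp => ?_) fun p hp => ?_
    · rw [F.mem_signPath] at hp ⊢
      rw [hV]
      exact Or.inr hp
    · rw [F.mem_signPath, hV] at hp
      rcases hp with rfl | hp
      · exact hopt.isUpper (F.isPath_signPath σ).increasing
          (F.mem_signPath.2 ((signVertex_mem_signVertices i hσi).2 rfl))
      · exact hoptτ.isUpper (F.isPath_signPath τ).increasing (F.mem_signPath.2 hp)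
  rcases (h _ fun h0 => hne (congrFun h0 i)).1 this with he | he
  · exact he.symm
  · rw [he, hτi] at hne
    exact absurd rfl hne

theorem IsFrame.exists_eq_update_of_polytopeAdj (F : IsFrame φ m top) (hn : 3 ≤ n)
    (hσ : σ ≠ 0) (hτ : τ ≠ 0)
    (h : PolytopeAdj (monotonePathPolytope (crossPolytope n) φ) (F.signAverage σ)
      (F.signAverage τ)) :
    ∃ i, (σ i ≠ 0 ∧ τ i = 0 ∧ σ = Function.update τ i (σ i)) ∨
      (τ i ≠ 0 ∧ σ i = 0 ∧ τ = Function.update σ i (τ i)) := by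
  have hn2 : 2 ≤ n := by omega
  obtain ⟨c, hc⟩ := F.exists_isOptimal_iff_of_polytopeAdj hn2 hσ hτ h
  by_contra! hcon
  have h0 : ∀ i, σ i = 0 ↔ τ i = 0 := by
    intro i
    constructor
    · intro hσi
      by_contra hτi
      exact (hcon i).2 hτi hσi (F.eq_update_of_isOptimal_iff hτ hσ
        (fun ρ hρ => (hc ρ hρ).trans or_comm) hτi hσi)
    · intro hτi
      by_contra hσi
      exact (hcon i).1 hσi hτi (F.eq_update_of_isOptimal_iff hσ hτ hc hσi hτi)
  have hne : σ ≠ τ := fun he => h.1 (by rw [he])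
  obtain ⟨i, hi⟩ := Function.ne_iff.1 hne
  have hopp : ∀ a b : SignType, (a = 0 ↔ b = 0) → a ≠ b → a ≠ 0 ∧ b ≠ 0 ∧ b = -a := by decide
  obtain ⟨hσi, hτi, hneg⟩ := hopp _ _ (h0 i) hi
  have hw := signVertex_mem_crossVertices i.1 hσi
  have hwne := F.signVertex_ne i hσi
  have hdeg := F.eq_mul_of_isUpper (c := c) hw hwne.1 hwne.2
    (((hc σ hσ).2 (Or.inl rfl)).isUpper (F.isPath_signPath σ).increasing
      (F.mem_signPath.2 ((signVertex_mem_signVertices i hσi).2 rfl)))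
    (((hc τ hτ).2 (Or.inr rfl)).isUpper (F.isPath_signPath τ).increasing
      (F.mem_signPath.2 (by
        rw [neg_signVertex, ← hneg]
        exact (signVertex_mem_signVertices i hτi).2 rfl)))
  obtain ⟨j, hj⟩ : ∃ j : {i : Fin n // i ≠ m}, j ≠ i := by
    have : Nontrivial {i : Fin n // i ≠ m} := by
      rw [← Fintype.one_lt_card_iff_nontrivial, Fintype.card_subtype_compl]
      simp
      omega
    exact exists_ne i
  have hthird : ∀ a b : SignType, ∃ z, z ≠ a ∧ z ≠ b := by decide
  obtain ⟨z, hz₁, hz₂⟩ := hthird (σ j) (τ j)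
  have hρ : Function.update σ j z ≠ 0 := fun h => hσi (by
    have := congrFun h i
    rwa [Function.update_of_ne hj.symm] at this)
  rcases (hc _ hρ).1 (F.isOptimal_of_eq_mul hdeg (F.isPath_signPath _)) with he | he
  · exact hz₁ (by rw [← he, Function.update_self])
  · exact hz₂ (by rw [← he, Function.update_self])

end MonotonePathPolytope

section Taxicab

variable {ι : Type*} [Fintype ι] {σ τ : ι → SignType}

theorem taxicabDist_comm (σ τ : ι → SignType) : taxicabDist σ τ = taxicabDist τ σ := by
  simp only [taxicabDist, abs_sub_comm]

theorem taxicabDist_update [DecidableEq ι] (i : ι) (hi : τ i = 0) {ε : SignType} (hε : ε ≠ 0) :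
    taxicabDist (Function.update τ i ε) τ = 1 := by
  rw [taxicabDist, Finset.sum_eq_single i]
  · rw [Function.update_self, hi]
    revert ε
    decide
  · intro j _ hj
    rw [Function.update_of_ne hj, sub_self, abs_zero]
  · simp

theorem taxicabDist_eq_one [DecidableEq ι] (h : taxicabDist σ τ = 1) :
    ∃ i, (σ i ≠ 0 ∧ τ i = 0 ∧ σ = Function.update τ i (σ i)) ∨
      (τ i ≠ 0 ∧ σ i = 0 ∧ τ = Function.update σ i (τ i)) := by
  have hne : ∃ i, σ i ≠ τ i := by
    by_contra! hcon
    simp [taxicabDist, hcon] at h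
  obtain ⟨i, hi⟩ := hne
  rw [taxicabDist, ← Finset.add_sum_erase _ _ (Finset.mem_univ i)] at h
  have hrest : 0 ≤ ∑ j ∈ Finset.univ.erase i, |(σ j : ℤ) - (τ j : ℤ)| :=
    Finset.sum_nonneg fun j _ => abs_nonneg _
  have hsign : ∀ a b : SignType, a ≠ b → 1 ≤ |(a : ℤ) - (b : ℤ)| := by decide
  have hsign' : ∀ a b : SignType, a ≠ b → |(a : ℤ) - (b : ℤ)| = 1 →
      (a ≠ 0 ∧ b = 0) ∨ (b ≠ 0 ∧ a = 0) := by decide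
  have h1 := hsign _ _ hi
  have heq : ∀ j, j ≠ i → σ j = τ j := by
    intro j hj
    by_contra hjne
    have h2 := hsign _ _ hjne
    have h3 : |(σ j : ℤ) - (τ j : ℤ)| ≤ ∑ j ∈ Finset.univ.erase i, |(σ j : ℤ) - (τ j : ℤ)| :=
      Finset.single_le_sum (f := fun j => |(σ j : ℤ) - (τ j : ℤ)|) (fun j _ => abs_nonneg _)
        (Finset.mem_erase.2 ⟨hj, Finset.mem_univ j⟩)
    omega
  refine ⟨i, (hsign' _ _ hi (by omega)).imp ?_ ?_⟩
  · rintro ⟨h₁, h₂⟩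
    exact ⟨h₁, h₂, Function.eq_update_iff.2 ⟨rfl, heq⟩⟩
  · rintro ⟨h₁, h₂⟩
    exact ⟨h₁, h₂, Function.eq_update_iff.2 ⟨rfl, fun j hj => (heq j hj).symm⟩⟩

end Taxicab

section SignVectorOf

variable {n : ℕ} {m : Fin n} {φ : EuclideanSpace ℝ (Fin n) →L[ℝ] ℝ}
  {top : EuclideanSpace ℝ (Fin n)} {σ : {i : Fin n // i ≠ m} → SignType}

theorem forall_mem_of_isChain {α : Type*} {R : α → α → Prop} {Q : α → Prop}
    (hR : ∀ p q, R p q → Q q) : ∀ {l : List α}, l.IsChain R → (∀ p ∈ l.head?, Q p) →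
      ∀ p ∈ l, Q p
  | [], _, _, p, hp => by simp at hp
  | [a], _, h, p, hp => h p (by simpa [eq_comm] using hp)
  | a :: b :: l, hl, h, p, hp => by
    rw [List.isChain_cons_cons] at hl
    rcases List.mem_cons.1 hp with rfl | hp
    · exact h p (by simp)
    · exact forall_mem_of_isChain hR hl.2 (fun q hq => hR a q (by
        have : b = q := by simpa using hq
        exact this ▸ hl.1)) p hp

theorem isChain_of_forall_infix {α : Type*} {R : α → α → Prop} :
    ∀ {l : List α}, (∀ p q, [p, q] <:+: l → R p q) → l.IsChain R
  | [], _ => by simp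
  | [a], _ => by simp
  | a :: b :: l, h => by
    rw [List.isChain_cons_cons]
    exact ⟨h a b ⟨[], l, by simp⟩, isChain_of_forall_infix fun p q hpq =>
      h p q (List.infix_cons_iff.2 (Or.inr hpq))⟩

theorem rel_of_isChain_of_infix {α : Type*} {R : α → α → Prop} {l : List α} (h : l.IsChain R)
    {p q : α} (hpq : [p, q] <:+: l) : R p q :=
  (List.isChain_cons_cons.1 (h.infix hpq)).1

theorem IsFrame.isMaxOn_top (F : IsFrame φ m top) : IsMaxOn φ (crossPolytope n) top :=
  fun _ hy => apply_le_of_mem_convexHull φ F.le_top hy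

theorem IsFrame.isMinOn_neg_top (F : IsFrame φ m top) : IsMinOn φ (crossPolytope n) (-top) :=
  fun _ hy => le_apply_of_mem_convexHull φ F.neg_top_le hy

theorem IsFrame.isMonotonePath_signPath (F : IsFrame φ m top) (hn : 2 ≤ n) (hσ : σ ≠ 0) :
    IsMonotonePath (crossPolytope n) φ (F.signPath σ) := by
  have hl := F.isPath_signPath σ
  refine ⟨⟨-top, ?_, ?_, F.isMinOn_neg_top⟩, ⟨top, ?_, ?_, F.isMaxOn_top⟩, ?_⟩
  · revert hl
    cases F.signPath σ with
    | nil => exact fun hl => absurd hl.bot_mem (by simp)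
    | cons p l =>
      intro hl
      rcases List.mem_cons.1 hl.bot_mem with h | h
      · simp [h]
      · exact absurd (List.rel_of_pairwise_cons hl.increasing h)
          (F.neg_top_le p (hl.subset p (by simp))).not_gt
  · rw [extremePoints_crossPolytope hn]
    exact F.neg_top_mem
  · revert hl
    rcases List.eq_nil_or_concat (F.signPath σ) with h | ⟨l, q, h⟩
    · rw [h]
      exact fun hl => absurd hl.top_mem (by simp)
    · rw [h, List.concat_eq_append]
      intro hl
      rcases List.mem_append.1 hl.top_mem with h | h
      · exact absurd ((List.pairwise_append.1 hl.increasing).2.2 _ h q (by simp))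
          (F.le_top q (hl.subset q (by simp))).not_gt
      · simp [List.mem_singleton.1 h]
  · rw [extremePoints_crossPolytope hn]
    exact F.top_mem
  · refine isChain_of_forall_infix fun p q hpq => ?_
    have hlt := hl.increasing.lt_of_infix hpq
    have hm := mem_of_pair_infix hpq
    refine ⟨hlt, polytopeAdj_crossPolytope (hl.subset p hm.1) (hl.subset q hm.2)
      (fun h => hlt.ne (congrArg φ h)) ?_⟩
    rintro rfl
    rcases F.cases_mem (hl.subset q hm.2) with rfl | rfl | ⟨i, ε, hε, rfl⟩
    · exact F.ne_top_of_infix hσ hpq ⟨rfl, rfl⟩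
    · exact absurd hlt (F.neg_top_le _ (hl.subset _ hm.1)).not_gt
    · have hε' : -ε ≠ 0 := by rcases SignType.eq_one_or_neg_one hε with h | h <;> rw [h] <;> decide
      have h₁ := (signVertex_mem_signVertices i hε).1 (F.mem_signPath.1 hm.2)
      rw [neg_signVertex] at hm
      have h₂ := (signVertex_mem_signVertices i hε').1 (F.mem_signPath.1 hm.1)
      rw [h₁] at h₂
      rcases SignType.eq_one_or_neg_one hε with rfl | rfl <;> exact absurd h₂ (by decide)

theorem IsFrame.eq_signPath_of_isMonotonePath (F : IsFrame φ m top) (hn : 2 ≤ n)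
    {l : List (EuclideanSpace ℝ (Fin n))} (hl : IsMonotonePath (crossPolytope n) φ l)
    (hmem : ∀ i : {i : Fin n // i ≠ m},
      (stdVec i.1 ∈ l ↔ σ i = 1) ∧ (-stdVec i.1 ∈ l ↔ σ i = -1)) :
    l = F.signPath σ ∧ σ ≠ 0 := by
  obtain ⟨⟨a, ha, haV, hamin⟩, ⟨b, hb, hbV, hbmax⟩, hchain⟩ := hl
  rw [extremePoints_crossPolytope hn] at haV hbV
  have hK := subset_convexHull ℝ (crossVertices n)
  obtain rfl : a = -top := F.inj haV F.neg_top_mem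
    (le_antisymm (hamin (hK F.neg_top_mem)) (F.neg_top_le a haV))
  obtain rfl : b = top := F.inj hbV F.top_mem
    (le_antisymm (F.le_top b hbV) (hbmax (hK F.top_mem)))
  have hbot : -b ∈ l := List.mem_of_mem_head? ha
  have htop : b ∈ l := List.mem_of_getLast? hb
  have hsub : ∀ p ∈ l, p ∈ crossVertices n := by
    refine forall_mem_of_isChain (fun p q hpq => ?_) hchain fun p hp => ?_
    · rw [← extremePoints_crossPolytope hn]
      exact hpq.2.mem_extremePoints.2
    · rw [Option.mem_unique hp ha]
      exact F.neg_top_mem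
  have hinc : IsIncreasing φ l := by
    have : Trans (fun p q : EuclideanSpace ℝ (Fin n) => φ p < φ q) (fun p q => φ p < φ q)
      fun p q => φ p < φ q := ⟨lt_trans⟩
    exact List.isChain_iff_pairwise.1 (hchain.imp fun _ _ h => h.1)
  have hiff : ∀ i : {i : Fin n // i ≠ m}, ∀ ε : SignType, ε ≠ 0 →
      (signVertex i.1 ε ∈ l ↔ σ i = ε) := by
    intro i ε hε
    rcases SignType.eq_one_or_neg_one hε with rfl | rfl
    · rw [signVertex_one]
      exact (hmem i).1
    · rw [signVertex_neg_one]
      exact (hmem i).2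
  constructor
  · refine F.eq_signPath hinc fun p => ?_
    by_cases hp : p ∈ crossVertices n
    · rcases F.cases_mem hp with rfl | rfl | ⟨i, ε, hε, rfl⟩
      · exact iff_of_true htop F.top_mem_signVertices
      · exact iff_of_true hbot F.neg_top_mem_signVertices
      · rw [hiff i ε hε, signVertex_mem_signVertices i hε]
    · exact iff_of_false (fun h => hp (hsub p h)) fun h => hp (signVertices_subset h)
  · rintro rfl
    have hall : ∀ p ∈ l, p = b ∨ p = -b := by
      intro p hp
      rcases F.cases_mem (hsub p hp) with h | h | ⟨i, ε, hε, rfl⟩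
      · exact Or.inl h
      · exact Or.inr h
      · exact absurd ((hiff i ε hε).1 hp).symm hε
    obtain ⟨p, q, hpq, -⟩ := exists_infix_between hinc hbot htop F.lt le_rfl F.lt.le
    have hlt := hinc.lt_of_infix hpq
    have hm := mem_of_pair_infix hpq
    have hlt' := F.lt
    have hadj := (rel_of_isChain_of_infix hchain hpq).2
    rcases hall p hm.1 with rfl | rfl <;> rcases hall q hm.2 with rfl | rfl
    · exact lt_irrefl _ hlt
    · exact hlt'.not_gt hlt
    · exact not_polytopeAdj_neg hn F.top_mem hadj
    · exact lt_irrefl _ hlt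

/-- A section running along an increasing path is the piecewise linear one. -/
theorem SectionTraces.eq_pathSection {E : Type*} [NormedAddCommGroup E] [NormedSpace ℝ E]
    {P : Set E} {φ : E →L[ℝ] ℝ} {s : ℝ → E} {l : List E} (h : SectionTraces P φ s l)
    (hl : IsIncreasing φ l) {x : ℝ} (hx : x ∈ φ '' P) : s x = pathSection φ l x := by
  obtain ⟨p, q, hpq, hs⟩ := h.2 x hx
  have := pathSection_eq_of_mem_segment hl hpq hs
  rw [(h.1.2 x hx).2] at this
  exact this.symm

theorem IsFrame.isSignVectorOf_iff (F : IsFrame φ m top) (hn : 2 ≤ n)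
    {v : EuclideanSpace ℝ (Fin n)} :
    IsSignVectorOf φ m v σ ↔ σ ≠ 0 ∧ v = F.signAverage σ := by
  have hmeas : MeasurableSet (φ '' crossPolytope n) := F.image_eq ▸ measurableSet_Icc
  constructor
  · rintro ⟨l, s, hl, hs, rfl, hmem⟩
    obtain ⟨rfl, hσ⟩ := F.eq_signPath_of_isMonotonePath hn hl hmem
    refine ⟨hσ, ?_⟩
    rw [signAverage, pathAverage, setAverage_eq, setAverage_eq]
    congr 1
    exact setIntegral_congr_fun hmeas fun x hx =>
      hs.eq_pathSection (F.isPath_signPath σ).increasing hx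
  · rintro ⟨hσ, rfl⟩
    have hl := F.isPath_signPath σ
    refine ⟨F.signPath σ, pathSection φ (F.signPath σ), F.isMonotonePath_signPath hn hσ,
      ⟨hl.isSection F, fun x hx => ?_⟩, rfl, fun i => ?_⟩
    · rw [F.image_eq] at hx
      obtain ⟨p, q, hpq, hp, hq⟩ := hl.exists_infix F.lt hx.1 hx.2
      refine ⟨p, q, hpq, ?_⟩
      rw [pathSection_eq_interp hl.increasing hpq hp hq]
      exact interp_mem_segment (hl.increasing.lt_of_infix hpq) hp hq
    · rw [← signVertex_neg_one, ← signVertex_one, F.mem_signPath, F.mem_signPath,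
        signVertex_mem_signVertices i (by decide), signVertex_mem_signVertices i (by decide)]
      exact ⟨Iff.rfl, Iff.rfl⟩

theorem IsFrame.polytopeAdj_iff (F : IsFrame φ m top) (hn : 3 ≤ n)
    {τ : {i : Fin n // i ≠ m} → SignType} (hσ : σ ≠ 0) (hτ : τ ≠ 0) :
    PolytopeAdj (monotonePathPolytope (crossPolytope n) φ) (F.signAverage σ) (F.signAverage τ) ↔
      taxicabDist σ τ = 1 := by
  have hn2 : 2 ≤ n := by omega
  constructor
  · intro h
    obtain ⟨i, ⟨h₁, h₂, h₃⟩ | ⟨h₁, h₂, h₃⟩⟩ := F.exists_eq_update_of_polytopeAdj hn hσ hτ h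
    · rw [h₃]
      exact taxicabDist_update i h₂ h₁
    · rw [taxicabDist_comm, h₃]
      exact taxicabDist_update i h₂ h₁
  · intro h
    obtain ⟨i, ⟨h₁, h₂, h₃⟩ | ⟨h₁, h₂, h₃⟩⟩ := taxicabDist_eq_one h
    · rw [h₃]
      exact (F.polytopeAdj_update hn2 hτ i h₂ h₁).symm
    · rw [h₃]
      exact F.polytopeAdj_update hn2 hσ i h₂ h₁

end SignVectorOf

theorem mainTheorem5 (n : ℕ) (hn : 3 ≤ n) (φ : EuclideanSpace ℝ (Fin n) →L[ℝ] ℝ)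
    (hφ : IsVertexGeneric (crossPolytope n) φ)
    (m : Fin n) (hm : ∀ i : Fin n, |φ (stdVec i)| ≤ |φ (stdVec m)|) :
    ∃ f : Set.extremePoints ℝ (monotonePathPolytope (crossPolytope n) φ) ≃
        {σ : {i : Fin n // i ≠ m} → SignType // σ ≠ 0},
      (∀ (v : Set.extremePoints ℝ (monotonePathPolytope (crossPolytope n) φ))
          (σ : {i : Fin n // i ≠ m} → SignType),
        IsSignVectorOf φ m v.1 σ ↔ σ = (f v).1) ∧
      ∀ v w : Set.extremePoints ℝ (monotonePathPolytope (crossPolytope n) φ),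
        PolytopeAdj (monotonePathPolytope (crossPolytope n) φ) v.1 w.1 ↔
          taxicabDist (f v).1 (f w).1 = 1 := by
  have hn2 : 2 ≤ n := by omega
  rw [IsVertexGeneric, extremePoints_crossPolytope hn2] at hφ
  obtain ⟨top, F⟩ := exists_isFrame hφ hm
  have hext := F.extremePoints_eq hn2
  let g : {σ : {i : Fin n // i ≠ m} → SignType // σ ≠ 0} →
      Set.extremePoints ℝ (monotonePathPolytope (crossPolytope n) φ) :=
    fun σ => ⟨F.signAverage σ.1, hext ▸ ⟨σ.1, σ.2, rfl⟩⟩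
  have hg : Function.Bijective g := by
    constructor
    · intro σ τ h
      exact Subtype.ext (F.signAverage_injOn σ.2 τ.2 (congrArg Subtype.val h))
    · rintro ⟨v, hv⟩
      obtain ⟨σ, hσ, rfl⟩ := hext ▸ hv
      exact ⟨⟨σ, hσ⟩, rfl⟩
  let e := Equiv.ofBijective g hg
  have hval : ∀ v, F.signAverage (e.symm v).1 = v.1 := fun v =>
    congrArg Subtype.val (e.apply_symm_apply v)
  refine ⟨e.symm, fun v σ => ?_, fun v w => ?_⟩
  · rw [F.isSignVectorOf_iff hn2, ← hval v]
    constructor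
    · rintro ⟨hσ, h⟩
      exact F.signAverage_injOn hσ (e.symm v).2 h.symm
    · rintro rfl
      exact ⟨(e.symm v).2, rfl⟩
  · rw [← hval v, ← hval w]
    exact F.polytopeAdj_iff hn (e.symm v).2 (e.symm w).2
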